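/- All logarithms are to base $2$. Let $X,Y$ be non-empty finite sets and $f:X\times Y\to\{0,1\}$ a Boolean function. A *private-coin SMP protocol* consists of independent random strings $R_A,R_B,R_C$ (held by Alice, Bob and the referee), finite message sets $M_A,M_B$, message functions $\Pi_A:X\times R_A\to M_A$, $\Pi_B:Y\times R_B\to M_B$ and an output function $\Pi_C:M_A\times M_B\times R_C\to\{0,1\}$. It computes $f$ with error $\epsilon$ if for every $(x,y)$ the referee's output differs from $f(x,y)$ with probability at most $\epsilon$. Its cost is $\lceil\log|M_A|\rceil+\lceil\log|M_B|\rceil$, and $CC_{priv}(f,\epsilon)$ is the minimum cost of a private-coin SMP protocol computing $f$ with error $\epsilon$. A *shared-randomness SMP protocol* is defined in the same way, with two further random strings, $R_{AC}$ shared by Alice and the referee and $R_{BC}$ shared by Bob and the referee, all five strings being independent; thus $\Pi_A:X\times R_A\times R_{AC}\to M_A$, $\Pi_B:Y\times R_B\times R_{BC}\to M_B$ and $\Pi_C:M_A\times M_B\times R_C\times R_{AC}\times R_{BC}\to\{0,1\}$. For a probability distribution $\mu$ on $X\times Y$, its information leakage is the mutual information $IL(\Pi,\mu)=I(XY;M_AM_BR_CR_{AC}R_{BC})$,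 where the inputs are distributed according to $\mu$ independently of the random strings, and $M_A,M_B$ denote the messages sent. Put $IL(\Pi)=\sup_\mu IL(\Pi,\mu)$, and let $IL(f,\epsilon)=\inf_\Pi IL(\Pi)$, over all shared-randomness SMP protocols $\Pi$ computing $f$ with error $\epsilon$. **Lemma.** For any such $f$, any $\epsilon\ge 0$ and any $\delta_1,\delta_2>0$ with $\epsilon+\delta_1+\delta_2<\frac12$, denote $n_A=\log|X|$ and $n_B=\log|Y|$. Then $$IL(f,\epsilon)\ \ge\ \delta_1\big(CC_{priv}(f,\epsilon+\delta_1+\delta_2)-g_2(n_A,n_B,\delta_2)-4\big)-2g_1\big(CC_{priv}(f,\epsilon)\big),$$ where $g_1(x)=2\log(x+1)+10$ and $g_2(x,y,z)=2\log\!\Big(\frac{2(x+y)}{z^2\cdot\log e}+1\Big)+2$. -/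

import Mathlib

open MeasureTheory
open scoped ENNReal

namespace SMP

/-- A private-coin simultaneous-message-passing protocol with inputs in `X` and `Y` and a Boolean
output: finite message sets, and independent private randomness for Alice, Bob and the referee.
The random strings live in arbitrary probability spaces. -/
structure PrivateProtocol (X Y : Type*) where
  /-- Alice's message set -/
  MA : Type
  /-- Bob's message set -/
  MB : Type
  /-- Alice's private randomness -/
  RA : Type
  /-- Bob's private randomness -/
  RB : Type
  /-- the referee's private randomness -/
  RC : Type
  [fintypeMA : Fintype MA]
  [fintypeMB : Fintype MB]
  [measMA : MeasurableSpace MA]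
  [measMB : MeasurableSpace MB]
  [discMA : DiscreteMeasurableSpace MA]
  [discMB : DiscreteMeasurableSpace MB]
  [measRA : MeasurableSpace RA]
  [measRB : MeasurableSpace RB]
  [measRC : MeasurableSpace RC]
  /-- distribution of `RA` -/
  lawA : Measure RA
  /-- distribution of `RB` -/
  lawB : Measure RB
  /-- distribution of `RC` -/
  lawC : Measure RC
  [probA : IsProbabilityMeasure lawA]
  [probB : IsProbabilityMeasure lawB]
  [probC : IsProbabilityMeasure lawC]
  /-- Alice's message function -/
  msgA : X → RA → MA
  /-- Bob's message function -/
  msgB : Y → RB → MB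
  /-- the referee's output function -/
  out : MA → MB → RC → Bool
  measurable_msgA : ∀ x, Measurable (msgA x)
  measurable_msgB : ∀ y, Measurable (msgB y)
  measurable_out : ∀ a b, Measurable (out a b)

/-- A shared-randomness simultaneous-message-passing protocol: besides the private randomness,
Alice and the referee share `RAC`, and Bob and the referee share `RBC`. All five random strings
are independent; nothing is shared between Alice and Bob. -/
structure SharedProtocol (X Y : Type*) where
  /-- Alice's message set -/
  MA : Type
  /-- Bob's message set -/
  MB : Type
  /-- Alice's private randomness -/
  RA : Type
  /-- Bob's private randomness -/
  RB : Type
  /-- the referee's private randomness -/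
  RC : Type
  /-- randomness shared between Alice and the referee -/
  RAC : Type
  /-- randomness shared between Bob and the referee -/
  RBC : Type
  [fintypeMA : Fintype MA]
  [fintypeMB : Fintype MB]
  [measMA : MeasurableSpace MA]
  [measMB : MeasurableSpace MB]
  [discMA : DiscreteMeasurableSpace MA]
  [discMB : DiscreteMeasurableSpace MB]
  [measRA : MeasurableSpace RA]
  [measRB : MeasurableSpace RB]
  [measRC : MeasurableSpace RC]
  [measRAC : MeasurableSpace RAC]
  [measRBC : MeasurableSpace RBC]
  /-- distribution of `RA` -/
  lawA : Measure RA
  /-- distribution of `RB` -/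
  lawB : Measure RB
  /-- distribution of `RC` -/
  lawC : Measure RC
  /-- distribution of `RAC` -/
  lawAC : Measure RAC
  /-- distribution of `RBC` -/
  lawBC : Measure RBC
  [probA : IsProbabilityMeasure lawA]
  [probB : IsProbabilityMeasure lawB]
  [probC : IsProbabilityMeasure lawC]
  [probAC : IsProbabilityMeasure lawAC]
  [probBC : IsProbabilityMeasure lawBC]
  /-- Alice's message function -/
  msgA : X → RA × RAC → MA
  /-- Bob's message function -/
  msgB : Y → RB × RBC → MB
  /-- the referee's output function -/
  out : MA → MB → RC × RAC × RBC → Bool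
  measurable_msgA : ∀ x, Measurable (msgA x)
  measurable_msgB : ∀ y, Measurable (msgB y)
  measurable_out : ∀ a b, Measurable (out a b)

attribute [instance] PrivateProtocol.fintypeMA PrivateProtocol.fintypeMB
  PrivateProtocol.measMA PrivateProtocol.measMB PrivateProtocol.discMA PrivateProtocol.discMB
  PrivateProtocol.measRA PrivateProtocol.measRB PrivateProtocol.measRC
  PrivateProtocol.probA PrivateProtocol.probB PrivateProtocol.probC

attribute [instance] SharedProtocol.fintypeMA SharedProtocol.fintypeMB
  SharedProtocol.measMA SharedProtocol.measMB SharedProtocol.discMA SharedProtocol.discMB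
  SharedProtocol.measRA SharedProtocol.measRB SharedProtocol.measRC
  SharedProtocol.measRAC SharedProtocol.measRBC
  SharedProtocol.probA SharedProtocol.probB SharedProtocol.probC
  SharedProtocol.probAC SharedProtocol.probBC

noncomputable section

namespace PrivateProtocol

variable {X Y : Type*} (P : PrivateProtocol X Y)

/-- All the random strings of the protocol. -/
abbrev Rand : Type := P.RA × P.RB × P.RC

/-- The joint distribution of the (independent) random strings. -/
def law : Measure P.Rand := P.lawA.prod (P.lawB.prod P.lawC)

/-- The referee's output on inputs `x`, `y` and random strings `r`. -/
def output (x : X) (y : Y) (r : P.Rand) : Bool :=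
  P.out (P.msgA x r.1) (P.msgB y r.2.1) r.2.2

/-- The protocol computes `f` with worst-case error at most `ε`. -/
def Computes (f : X → Y → Bool) (ε : ℝ) : Prop :=
  ∀ x y, P.law.real {r | P.output x y r ≠ f x y} ≤ ε

/-- The communication cost `⌈log₂ |M_A|⌉ + ⌈log₂ |M_B|⌉`. -/
def cost : ℕ := Nat.clog 2 (Fintype.card P.MA) + Nat.clog 2 (Fintype.card P.MB)

end PrivateProtocol

namespace SharedProtocol

variable {X Y : Type*} (P : SharedProtocol X Y)

/-- All the random strings of the protocol. -/
abbrev Rand : Type := P.RA × P.RB × P.RC × P.RAC × P.RBC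

/-- The joint distribution of the (independent) random strings. -/
def law : Measure P.Rand :=
  P.lawA.prod (P.lawB.prod (P.lawC.prod (P.lawAC.prod P.lawBC)))

/-- What the referee holds at the end of the protocol: `M_A M_B R_C R_AC R_BC`. -/
abbrev View : Type := P.MA × P.MB × P.RC × P.RAC × P.RBC

/-- The referee's view on inputs `z = (x, y)` and random strings `r`. -/
def view (z : X × Y) (r : P.Rand) : P.View :=
  (P.msgA z.1 (r.1, r.2.2.2.1), P.msgB z.2 (r.2.1, r.2.2.2.2), r.2.2)

/-- The referee's output on inputs `x`, `y` and random strings `r`. -/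
def output (x : X) (y : Y) (r : P.Rand) : Bool :=
  P.out (P.msgA x (r.1, r.2.2.2.1)) (P.msgB y (r.2.1, r.2.2.2.2)) r.2.2

/-- The protocol computes `f` with worst-case error at most `ε`. -/
def Computes (f : X → Y → Bool) (ε : ℝ) : Prop :=
  ∀ x y, P.law.real {r | P.output x y r ≠ f x y} ≤ ε

end SharedProtocol

/-- The mutual information `I(U ; V)`, in bits, of two random variables on `(Ω, ν)`: the relative
entropy of their joint law with respect to the product of their laws. -/
def mutualInfo {Ω α β : Type*} [MeasurableSpace Ω] [MeasurableSpace α] [MeasurableSpace β]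
    (ν : Measure Ω) (U : Ω → α) (V : Ω → β) : ℝ≥0∞ :=
  InformationTheory.klDiv (ν.map fun ω => (U ω, V ω)) ((ν.map U).prod (ν.map V)) /
    ENNReal.ofReal (Real.log 2)

section Complexity

variable {X Y : Type*}

/-- `IL(Π, μ) = I(XY ; M_A M_B R_C R_AC R_BC)`, where `(X, Y)` has law `μ` and is independent of
the random strings of the protocol. -/
def SharedProtocol.leakageOn [MeasurableSpace X] [MeasurableSpace Y] (P : SharedProtocol X Y)
    (μ : Measure (X × Y)) : ℝ≥0∞ :=
  mutualInfo (μ.prod P.law) (fun ω => ω.1) (fun ω => P.view ω.1 ω.2)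

/-- `IL(Π)`: the supremum of `IL(Π, μ)` over all input distributions `μ`. -/
def SharedProtocol.leakage [MeasurableSpace X] [MeasurableSpace Y]
    (P : SharedProtocol X Y) : ℝ≥0∞ :=
  ⨆ (μ : Measure (X × Y)) (_ : IsProbabilityMeasure μ), P.leakageOn μ

/-- The information leakage `IL(f, ε)`. -/
def IL [MeasurableSpace X] [MeasurableSpace Y] (f : X → Y → Bool) (ε : ℝ) : ℝ≥0∞ :=
  ⨅ (P : SharedProtocol X Y) (_ : P.Computes f ε), P.leakage

/-- The private-coin communication complexity `CC_priv(f, ε)`. -/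
def CCpriv (f : X → Y → Bool) (ε : ℝ) : ℕ :=
  sInf {c | ∃ P : PrivateProtocol X Y, P.Computes f ε ∧ P.cost = c}

end Complexity

/-- `g₁(x) = 2 log₂(x + 1) + 10`. -/
def g₁ (x : ℝ) : ℝ := 2 * Real.logb 2 (x + 1) + 10

/-- `g₂(x, y, z) = 2 log₂(2 (x + y) / (z² log₂ e) + 1) + 2`. -/
def g₂ (x y z : ℝ) : ℝ :=
  2 * Real.logb 2 (2 * (x + y) / (z ^ 2 * Real.logb 2 (Real.exp 1)) + 1) + 2

end

end SMP

namespace SMP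

/-! A shared-randomness protocol that leaks `L` bits can be compressed to a private-coin protocol of
cost about `L / δ₁`. The map from `x` to the law of `(M_A, R_AC)` is a channel, and likewise on
Bob's side. An input distribution that nearly maximises the information of a channel has an output
law whose relative entropy from every row is hardly larger than that information
(`exists_weight_relEnt_le`). On a product of two such distributions the leakage is the sum of the
two channel informations (`toReal_klDiv_view`), so the two worst-case divergences together are at
most `L + 2` bits.

Given the shared string, the referee knows the mixed law of the message, so `N` samples of it can be
added to the shared string. A player then sends only the index picked by greedy rejection sampling,
which fails with probability at most `(D + 2) / log N` for a divergence of `D` nats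
(`residual_mul_log_le`). With `log₂ N` about `D / δ₁` bits each player fails with probability at
most `δ₁`; the referee then tosses a fair coin, so the two failures together add at most `δ₁` to the
error.

The shared seeds are removed as in Newman's theorem: by Hoeffding's inequality and a union bound
there are `T` fixed seeds per side whose uniform average exceeds no error probability by more than
`δ₂ / 2` per side. Each player draws a seed privately and sends its index, and `2 ⌈log₂ T⌉ ≤ g₂`.
Altogether `δ₁ (CC - g₂ - 4) ≤ L + 8`, and `2 g₁ ≥ 20` absorbs the `8`. -/

instance SharedProtocol.isProbabilityMeasure_law {X Y : Type*} (P : SharedProtocol X Y) :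
    IsProbabilityMeasure P.law := by
  unfold SharedProtocol.law; infer_instance

/-! ### Sampling of seeds and realisation of behavioural strategies -/

open ProbabilityTheory in
/-- Sampling `T` seeds simultaneously approximates finitely many bounded expectations from above. -/
theorem exists_sample_average_le {A Z : Type*} [MeasurableSpace A] [Fintype Z] (ν : Measure A)
    [IsProbabilityMeasure ν] (g : Z → A → ℝ) (hg : ∀ z, Measurable (g z))
    (hg01 : ∀ z a, g z a ∈ Set.Icc (0 : ℝ) 1) {T : ℕ} (hT : 0 < T) {δ : ℝ} (hδ : 0 < δ)
    (hcard : Fintype.card Z * Real.exp (-(2 * T * δ ^ 2)) < 1) :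
    ∃ a : Fin T → A, ∀ z, (∑ t, g z (a t)) / T ≤ ∫ s, g z s ∂ν + δ := by
  classical
  set μ : Measure (Fin T → A) := Measure.pi fun _ => ν
  have hT' : (0 : ℝ) < T := by exact_mod_cast hT
  have key : ∀ z, μ.real {ω | T * δ ≤ ∑ i, (g z (ω i) - ∫ s, g z s ∂ν)}
      ≤ Real.exp (-(2 * T * δ ^ 2)) := by
    intro z
    have hind : iIndepFun (fun (i : Fin T) (ω : Fin T → A) => g z (ω i) - ∫ s, g z s ∂ν) μ :=
      iIndepFun_pi (μ := fun _ : Fin T => ν) (X := fun _ a => g z a - ∫ s, g z s ∂ν)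
        fun _ => ((hg z).sub_const _).aemeasurable
    have hsub : ∀ i ∈ (Finset.univ : Finset (Fin T)),
        HasSubgaussianMGF (fun ω : Fin T → A => g z (ω i) - ∫ s, g z s ∂ν)
          ((‖(1 : ℝ) - 0‖₊ / 2) ^ 2) μ := by
      intro i _
      have h := hasSubgaussianMGF_of_mem_Icc (μ := μ) (X := fun ω => g z (ω i)) (a := 0) (b := 1)
        ((hg z).comp (measurable_pi_apply i)).aemeasurable (Filter.Eventually.of_forall
          fun ω => hg01 z (ω i))
      have hintg : ∫ ω, g z (ω i) ∂μ = ∫ s, g z s ∂ν := by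
        have hmp := measurePreserving_eval (fun _ : Fin T => ν) i
        rw [← hmp.map_eq, integral_map (measurable_pi_apply i).aemeasurable
          (hg z).aestronglyMeasurable]
      rwa [hintg] at h
    -- Hoeffding: a `[0, 1]`-valued variable has variance proxy `1 / 4`, so a deviation `T δ` has
    -- probability at most `exp (-(T δ)² / (2 T / 4))`.
    have h := HasSubgaussianMGF.measure_sum_ge_le_of_iIndepFun hind hsub
      (ε := T * δ) (by positivity)
    refine h.trans (Real.exp_le_exp.mpr (le_of_eq ?_))
    simp
    field_simp
  have hbad : μ.real (⋃ z, {ω | T * δ ≤ ∑ i, (g z (ω i) - ∫ s, g z s ∂ν)}) < 1 := by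
    refine (measureReal_iUnion_fintype_le _).trans_lt (lt_of_le_of_lt
      (Finset.sum_le_sum fun z _ => key z) ?_)
    simpa using hcard
  have hne : (⋃ z, {ω : Fin T → A | T * δ ≤ ∑ i, (g z (ω i) - ∫ s, g z s ∂ν)}) ≠ Set.univ := by
    intro h
    rw [h, probReal_univ] at hbad
    exact lt_irrefl _ hbad
  obtain ⟨a, ha⟩ := (Set.ne_univ_iff_exists_notMem _).mp hne
  refine ⟨a, fun z => ?_⟩
  simp only [Set.mem_iUnion, Set.mem_ofPred_eq, not_exists, not_le] at ha
  have := ha z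
  rw [Finset.sum_sub_distrib] at this
  simp at this
  rw [div_le_iff₀ hT']
  nlinarith

/-- A family of finite distributions is realised by a family of random variables on a common
probability space. -/
theorem exists_coupling (S M : Type) [Fintype S] [Fintype M] [MeasurableSpace M]
    [DiscreteMeasurableSpace M] (α : S → M → ℝ) (h0 : ∀ s m, 0 ≤ α s m)
    (h1 : ∀ s, ∑ m, α s m = 1) :
    ∃ ν : Measure (S → M), IsProbabilityMeasure ν ∧
      ∀ s m, ν {r | r s = m} = ENNReal.ofReal (α s m) := by
  classical
  let ρ : S → Measure M := fun s => ∑ m, ENNReal.ofReal (α s m) • Measure.dirac m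
  have hρ : ∀ s m, ρ s {m} = ENNReal.ofReal (α s m) := by
    intro s m
    simp [ρ, Measure.finsetSum_apply, Set.indicator_apply]
  have hp : ∀ s, IsProbabilityMeasure (ρ s) := by
    intro s
    refine ⟨?_⟩
    simp [ρ, Measure.finsetSum_apply, ← ENNReal.ofReal_sum_of_nonneg fun m _ => h0 s m, h1]
  refine ⟨Measure.pi ρ, inferInstance, fun s m => ?_⟩
  have hmp := measurePreserving_eval ρ s
  rw [← hρ, ← hmp.map_eq, Measure.map_apply (measurable_pi_apply s) (measurableSet_singleton m)]
  rfl

/-- Behavioural strategies of the players yield a private-coin protocol. -/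
theorem exists_privateProtocol {X Y : Type*} [Fintype X] [Fintype Y] (MA MB : Type) [Fintype MA]
    [Fintype MB] (α : X → MA → ℝ) (hα0 : ∀ x m, 0 ≤ α x m) (hα1 : ∀ x, ∑ m, α x m = 1)
    (β : Y → MB → ℝ) (hβ0 : ∀ y m, 0 ≤ β y m) (hβ1 : ∀ y, ∑ m, β y m = 1)
    (γ : MA → MB → Bool → ℝ) (hγ0 : ∀ a b v, 0 ≤ γ a b v) (hγ1 : ∀ a b, ∑ v, γ a b v = 1)
    (f : X → Y → Bool) (ε : ℝ)
    (h : ∀ x y, ∑ a, ∑ b, α x a * β y b * γ a b (!f x y) ≤ ε) :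
    ∃ P : PrivateProtocol X Y, P.Computes f ε ∧
      P.cost = Nat.clog 2 (Fintype.card MA) + Nat.clog 2 (Fintype.card MB) := by
  classical
  let : MeasurableSpace MA := ⊤
  let : MeasurableSpace MB := ⊤
  -- The coins are indexed by `Fin (Fintype.card X)` because `RA` has to lie in `Type`, while `X`
  -- may live in any universe.
  obtain ⟨νA, hpA, hνA⟩ := exists_coupling (Fin (Fintype.card X)) MA
    (fun s => α ((Fintype.equivFin X).symm s)) (fun s => hα0 _) (fun s => hα1 _)
  obtain ⟨νB, hpB, hνB⟩ := exists_coupling (Fin (Fintype.card Y)) MB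
    (fun s => β ((Fintype.equivFin Y).symm s)) (fun s => hβ0 _) (fun s => hβ1 _)
  obtain ⟨νC, hpC, hνC⟩ := exists_coupling (MA × MB) Bool
    (fun s => γ s.1 s.2) (fun s => hγ0 _ _) (fun s => hγ1 _ _)
  let P : PrivateProtocol X Y :=
    { MA := MA, MB := MB, RA := Fin (Fintype.card X) → MA, RB := Fin (Fintype.card Y) → MB
      RC := MA × MB → Bool
      lawA := νA, lawB := νB, lawC := νC
      msgA := fun x r => r (Fintype.equivFin X x)
      msgB := fun y r => r (Fintype.equivFin Y y)
      out := fun a b r => r (a, b)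
      measurable_msgA := fun x => measurable_pi_apply _
      measurable_msgB := fun x => measurable_pi_apply _
      measurable_out := fun a b => measurable_pi_apply _ }
  refine ⟨P, fun x y => ?_, rfl⟩
  refine le_trans ?_ (h x y)
  -- Split by the pair of messages, the error event is covered by boxes, whose probabilities factor.
  have hsub : {r | P.output x y r ≠ f x y} ⊆ ⋃ s : MA × MB,
      {r : Fin (Fintype.card X) → MA | r (Fintype.equivFin X x) = s.1} ×ˢ
        ({r : Fin (Fintype.card Y) → MB | r (Fintype.equivFin Y y) = s.2} ×ˢ
          {r : MA × MB → Bool | r s = !f x y}) := by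
    rintro ⟨ra, rb, rc⟩ hr
    simp only [Set.mem_iUnion, Set.mem_prod, Set.mem_ofPred_eq]
    refine ⟨(ra (Fintype.equivFin X x), rb (Fintype.equivFin Y y)), rfl, rfl, ?_⟩
    have : rc (ra (Fintype.equivFin X x), rb (Fintype.equivFin Y y)) ≠ f x y := hr
    exact Bool.eq_not.mpr this
  change (νA.prod (νB.prod νC)).real _ ≤ _
  refine (measureReal_mono hsub (measure_ne_top _ _)).trans
    ((measureReal_iUnion_fintype_le _).trans (le_of_eq ?_))
  rw [Fintype.sum_prod_type]
  refine Finset.sum_congr rfl fun a _ => Finset.sum_congr rfl fun b _ => ?_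
  rw [measureReal_prod_prod, measureReal_prod_prod, measureReal_def, measureReal_def,
    measureReal_def, hνA, hνB, hνC]
  simp [hα0, hβ0, hγ0, mul_assoc]

/-! ### Relative entropy and channel information -/

/-- Pointwise Gibbs inequality, from `1 - 1 / u ≤ log u`. Once integrated or summed, it replaces
Jensen's inequality throughout. -/
theorem sub_le_mul_log_div {p q : ℝ} (hp : 0 ≤ p) (hq : 0 ≤ q) (h : q = 0 → p = 0) :
    p - q ≤ p * Real.log (p / q) := by
  rcases hp.eq_or_lt with rfl | hp
  · simpa using hq
  have hq : 0 < q := hq.lt_of_ne fun h' => hp.ne' (h h'.symm)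
  have := Real.one_sub_inv_le_log_of_pos (div_pos hp hq)
  calc p - q = p * (1 - (p / q)⁻¹) := by field_simp
    _ ≤ _ := by gcongr

theorem mul_log_div_le {p q K : ℝ} (hp : 0 ≤ p) (hq : 0 ≤ q) (h : p ≤ K * q) :
    p * Real.log (p / q) ≤ p * Real.log K := by
  rcases hp.eq_or_lt with rfl | hp
  · simp
  have hq : 0 < q := hq.lt_of_ne fun h' => by rw [← h'] at h; linarith
  gcongr
  rwa [div_le_iff₀ hq]

/-- Relative entropy, in nats, of two densities with respect to `σ`. -/
noncomputable def relEnt {S : Type*} [MeasurableSpace S] (σ : Measure S) (p q : S → ℝ) : ℝ :=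
  ∫ s, p s * Real.log (p s / q s) ∂σ

/-- Domination `p ≤ K * q` makes the integrand of `relEnt` bounded, so that every divergence below
is a convergent integral. -/
theorem abs_mul_log_div_le {p q K : ℝ} (hp0 : 0 ≤ p) (hp1 : p ≤ 1) (hq0 : 0 ≤ q) (hq1 : q ≤ 1)
    (h : p ≤ K * q) : |p * Real.log (p / q)| ≤ |Real.log K| + 1 := by
  rw [abs_le]
  have h1 := sub_le_mul_log_div hp0 hq0 fun h' => by rw [h'] at h; linarith
  have h2 := mul_log_div_le hp0 hq0 h
  have h3 : p * Real.log K ≤ |Real.log K| :=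
    (mul_le_mul_of_nonneg_left (le_abs_self _) hp0).trans
      (mul_le_of_le_one_left (abs_nonneg _) hp1)
  constructor
  · linarith [abs_nonneg (Real.log K)]
  · linarith

theorem integrable_mul_log_div {S : Type*} [MeasurableSpace S] {σ : Measure S} [IsFiniteMeasure σ]
    {p q : S → ℝ} (hp : Measurable p) (hq : Measurable q) (hp0 : ∀ s, 0 ≤ p s)
    (hp1 : ∀ s, p s ≤ 1) (hq0 : ∀ s, 0 ≤ q s) (hq1 : ∀ s, q s ≤ 1) {K : ℝ}
    (h : ∀ s, p s ≤ K * q s) :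
    Integrable (fun s => p s * Real.log (p s / q s)) σ :=
  Integrable.of_bound (C := |Real.log K| + 1)
    (hp.mul (hp.div hq).log).aestronglyMeasurable (Filter.Eventually.of_forall fun s =>
      abs_mul_log_div_le (hp0 s) (hp1 s) (hq0 s) (hq1 s) (h s))

theorem relEnt_nonneg {S : Type*} [MeasurableSpace S] {σ : Measure S} [IsFiniteMeasure σ]
    {p q : S → ℝ} (hp : Measurable p) (hq : Measurable q) (hp0 : ∀ s, 0 ≤ p s)
    (hp1 : ∀ s, p s ≤ 1) (hq0 : ∀ s, 0 ≤ q s) (hq1 : ∀ s, q s ≤ 1) {K : ℝ}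
    (h : ∀ s, p s ≤ K * q s) (heq : ∫ s, p s ∂σ = ∫ s, q s ∂σ) : 0 ≤ relEnt σ p q := by
  have hpi : Integrable p σ := Integrable.of_bound (C := 1) hp.aestronglyMeasurable
    (Filter.Eventually.of_forall fun s => by rw [Real.norm_of_nonneg (hp0 s)]; exact hp1 s)
  have hqi : Integrable q σ := Integrable.of_bound (C := 1) hq.aestronglyMeasurable
    (Filter.Eventually.of_forall fun s => by rw [Real.norm_of_nonneg (hq0 s)]; exact hq1 s)
  calc (0 : ℝ) = ∫ s, (p s - q s) ∂σ := by rw [integral_sub hpi hqi, heq, sub_self]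
    _ ≤ _ := integral_mono (hpi.sub hqi) (integrable_mul_log_div hp hq hp0 hp1 hq0 hq1 h)
      fun s => sub_le_mul_log_div (hp0 s) (hq0 s) fun h' => by
        have := h s; rw [h'] at this; linarith [hp0 s]

/-- A measurable family of densities with values in `[0, 1]`. -/
structure IsDensityFamily {ι S : Type*} [MeasurableSpace S] (σ : Measure S) (p : ι → S → ℝ) :
    Prop where
  measurable : ∀ i, Measurable (p i)
  nonneg : ∀ i s, 0 ≤ p i s
  le_one : ∀ i s, p i s ≤ 1
  integral : ∀ i, ∫ s, p i s ∂σ = 1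

/-- The weights `w` form a probability vector all of whose entries are at least `c`. -/
structure IsWeight {ι : Type*} [Fintype ι] (c : ℝ) (w : ι → ℝ) : Prop where
  le : ∀ i, c ≤ w i
  sum : ∑ i, w i = 1

/-- The mixture of the densities `p` with weights `w`. -/
def mixture {ι S : Type*} [Fintype ι] (w : ι → ℝ) (p : ι → S → ℝ) (s : S) : ℝ :=
  ∑ i, w i * p i s

/-- The mutual information, in nats, of the channel `p` with input distribution `w`. -/
noncomputable def channelInfo {ι S : Type*} [Fintype ι] [MeasurableSpace S] (σ : Measure S)
    (p : ι → S → ℝ) (w : ι → ℝ) : ℝ :=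
  ∑ i, w i * relEnt σ (p i) (mixture w p)

/-! ### Near-optimal input distributions of a channel -/

section Capacity

set_option linter.unusedSectionVars false

variable {ι S : Type*} [Fintype ι] [MeasurableSpace S] {σ : Measure S} [IsFiniteMeasure σ]
  {p : ι → S → ℝ} {c : ℝ} {w v : ι → ℝ}

theorem IsDensityFamily.integrable (hp : IsDensityFamily σ p) (i : ι) : Integrable (p i) σ :=
  Integrable.of_bound (C := 1) (hp.measurable i).aestronglyMeasurable
    (Filter.Eventually.of_forall fun s => by
      rw [Real.norm_of_nonneg (hp.nonneg i s)]; exact hp.le_one i s)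

theorem IsDensityFamily.measurable_mixture (hp : IsDensityFamily σ p) (w : ι → ℝ) :
    Measurable (mixture w p) :=
  Finset.measurable_sum _ fun i _ => (hp.measurable i).const_mul _

theorem IsWeight.nonneg (hc : 0 < c) (hw : IsWeight c w) (i : ι) : 0 ≤ w i :=
  hc.le.trans (hw.le i)

theorem IsWeight.le_one (hc : 0 < c) (hw : IsWeight c w) (i : ι) : w i ≤ 1 := by
  rw [← hw.sum]
  exact Finset.single_le_sum (fun j _ => hw.nonneg hc j) (Finset.mem_univ i)

theorem IsWeight.mixture_nonneg (hc : 0 < c) (hw : IsWeight c w) (hp : IsDensityFamily σ p)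
    (s : S) : 0 ≤ mixture w p s :=
  Finset.sum_nonneg fun i _ => mul_nonneg (hw.nonneg hc i) (hp.nonneg i s)

theorem IsWeight.mixture_le_one (hc : 0 < c) (hw : IsWeight c w) (hp : IsDensityFamily σ p)
    (s : S) : mixture w p s ≤ 1 := by
  rw [← hw.sum]
  exact Finset.sum_le_sum fun i _ => mul_le_of_le_one_right (hw.nonneg hc i) (hp.le_one i s)

theorem IsWeight.integral_mixture (hw : IsWeight c w) (hp : IsDensityFamily σ p) :
    ∫ s, mixture w p s ∂σ = 1 := by
  unfold mixture
  rw [integral_finsetSum _ fun i _ => (hp.integrable i).const_mul _]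
  simp [integral_const_mul, hp.integral, hw.sum]

/-- This is the purpose of the floor `c` on the weights: each row is dominated by every admissible
mixture, which keeps the divergences finite. -/
theorem IsWeight.le_mul_mixture (hc : 0 < c) (hw : IsWeight c w) (hp : IsDensityFamily σ p)
    (i : ι) (s : S) : p i s ≤ c⁻¹ * mixture w p s := by
  rw [← div_eq_inv_mul, le_div_iff₀ hc, mul_comm]
  refine (mul_le_mul_of_nonneg_right (hw.le i) (hp.nonneg i s)).trans ?_
  exact Finset.single_le_sum (f := fun i => w i * p i s)
    (fun j _ => mul_nonneg (hw.nonneg hc j) (hp.nonneg j s)) (Finset.mem_univ i)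

theorem IsWeight.integrable_mul_log (hc : 0 < c) (hw : IsWeight c w) (hp : IsDensityFamily σ p)
    (i : ι) : Integrable (fun s => p i s * Real.log (p i s / mixture w p s)) σ :=
  integrable_mul_log_div (hp.measurable i) (hp.measurable_mixture w) (hp.nonneg i) (hp.le_one i)
    (hw.mixture_nonneg hc hp) (hw.mixture_le_one hc hp)
    (hw.le_mul_mixture hc hp i)

theorem IsWeight.relEnt_nonneg (hc : 0 < c) (hw : IsWeight c w) (hp : IsDensityFamily σ p)
    (i : ι) : 0 ≤ relEnt σ (p i) (mixture w p) :=
  SMP.relEnt_nonneg (hp.measurable i) (hp.measurable_mixture w) (hp.nonneg i) (hp.le_one i)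
    (hw.mixture_nonneg hc hp) (hw.mixture_le_one hc hp)
    (hw.le_mul_mixture hc hp i) (by rw [hp.integral, hw.integral_mixture hp])

/-- Only boundedness matters: the supremum of the channel information over admissible weights is
finite. -/
theorem IsWeight.channelInfo_le (hc : 0 < c) (hw : IsWeight c w) (hp : IsDensityFamily σ p) :
    channelInfo σ p w ≤ Real.log c⁻¹ := by
  have h : ∀ i, relEnt σ (p i) (mixture w p) ≤ Real.log c⁻¹ := by
    intro i
    calc relEnt σ (p i) (mixture w p) ≤ ∫ s, p i s * Real.log c⁻¹ ∂σ :=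
          integral_mono (hw.integrable_mul_log hc hp i) ((hp.integrable i).mul_const _)
            fun s => mul_log_div_le (hp.nonneg i s) (hw.mixture_nonneg hc hp s)
              (hw.le_mul_mixture hc hp i s)
      _ = _ := by rw [integral_mul_const, hp.integral, one_mul]
  calc channelInfo σ p w ≤ ∑ i, w i * Real.log c⁻¹ :=
        Finset.sum_le_sum fun i _ => mul_le_mul_of_nonneg_left (h i) (hw.nonneg hc i)
    _ = _ := by rw [← Finset.sum_mul, hw.sum, one_mul]

/-- The mixture is the best single approximation of a weighted family of densities. -/
theorem IsWeight.channelInfo_le_sum (hc : 0 < c) (hw : IsWeight c w) (hv : IsWeight c v)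
    (hp : IsDensityFamily σ p) :
    channelInfo σ p w ≤ ∑ i, w i * relEnt σ (p i) (mixture v p) := by
  have hintg : ∀ {u : ι → ℝ}, IsWeight c u → ∀ i, Integrable
      (fun s => w i * (p i s * Real.log (p i s / mixture u p s))) σ :=
    fun hu i => (hu.integrable_mul_log hc hp i).const_mul _
  have hmi : ∀ {u : ι → ℝ}, IsWeight c u → Integrable (mixture u p) σ := fun {u} _ =>
    integrable_finsetSum _ fun i _ => (hp.integrable i).const_mul _
  unfold channelInfo relEnt
  simp_rw [← integral_const_mul]
  rw [← integral_finsetSum _ fun i _ => hintg hw i, ← integral_finsetSum _ fun i _ => hintg hv i]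
  -- The difference of the two sides is the relative entropy of the `w`-mixture from the
  -- `v`-mixture. Its integrand is at least the difference of the mixtures, which integrates to
  -- zero.
  have hz : ∫ s, (mixture w p s - mixture v p s) ∂σ = 0 := by
    rw [integral_sub (hmi hw) (hmi hv), hw.integral_mixture hp, hv.integral_mixture hp, sub_self]
  rw [← sub_nonneg, ← integral_sub (integrable_finsetSum _ fun i _ => hintg hv i)
    (integrable_finsetSum _ fun i _ => hintg hw i), ← hz]
  refine integral_mono ((hmi hw).sub (hmi hv)) ((integrable_finsetSum _ fun i _ => hintg hv i).sub
    (integrable_finsetSum _ fun i _ => hintg hw i)) fun s => ?_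
  have hpos : ∀ {u : ι → ℝ}, IsWeight c u → ∀ i, p i s ≠ 0 → 0 < mixture u p s := by
    intro u hu i hi
    have := hu.le_mul_mixture hc hp i s
    have hi : 0 < p i s := (hp.nonneg i s).lt_of_ne' hi
    exact pos_of_mul_pos_right (hi.trans_le this) (inv_pos.mpr hc).le
  have hid : ∀ i, w i * (p i s * Real.log (p i s / mixture v p s))
      - w i * (p i s * Real.log (p i s / mixture w p s))
      = w i * p i s * Real.log (mixture w p s / mixture v p s) := by
    intro i
    by_cases hi : p i s = 0
    · simp [hi]
    have h1 := hpos hw i hi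
    have h2 := hpos hv i hi
    rw [Real.log_div hi h1.ne', Real.log_div hi h2.ne', Real.log_div h1.ne' h2.ne']
    ring
  simp only []
  rw [← Finset.sum_sub_distrib, Finset.sum_congr rfl fun i _ => hid i, ← Finset.sum_mul]
  refine sub_le_mul_log_div (hw.mixture_nonneg hc hp s) (hv.mixture_nonneg hc hp s) fun h0 => ?_
  refine Finset.sum_eq_zero fun i _ => ?_
  by_contra hne
  exact (hpos hv i (right_ne_zero_of_mul hne)).ne' h0

/-- As `v j ≤ 1 ≤ w j / c`, the mixture of `u` is at most `1 + τ / c` times that of `w`; then `log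
(1 + x) ≤ x`. -/
theorem IsWeight.relEnt_le_of_convex (hc : 0 < c) (hw : IsWeight c w) (hv : IsWeight c v)
    (hp : IsDensityFamily σ p) {τ : ℝ} (hτ0 : 0 < τ) {u : ι → ℝ}
    (hu : ∀ i, u i = (1 - τ) * w i + τ * v i) (huw : IsWeight c u) (i : ι) :
    relEnt σ (p i) (mixture w p) ≤ relEnt σ (p i) (mixture u p) + τ * c⁻¹ := by
  have hle : ∀ s, mixture u p s ≤ (1 + τ * c⁻¹) * mixture w p s := by
    intro s
    unfold mixture
    rw [Finset.mul_sum]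
    refine Finset.sum_le_sum fun j _ => ?_
    rw [← mul_assoc]
    refine mul_le_mul_of_nonneg_right ?_ (hp.nonneg j s)
    have h1 : v j ≤ c⁻¹ * w j := by
      rw [← div_eq_inv_mul, le_div_iff₀ hc]
      exact (mul_le_of_le_one_left hc.le (hv.le_one hc j)).trans (hw.le j)
    have h2 := hw.nonneg hc j
    rw [hu]
    nlinarith
  have hpt : ∀ s, p i s * Real.log (p i s / mixture w p s) ≤
      p i s * Real.log (p i s / mixture u p s) + p i s * (τ * c⁻¹) := by
    intro s
    rcases (hp.nonneg i s).eq_or_lt with h0 | h0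
    · simp [← h0]
    have hwpos : 0 < mixture w p s :=
      pos_of_mul_pos_right (h0.trans_le (hw.le_mul_mixture hc hp i s)) (inv_pos.mpr hc).le
    have hupos : 0 < mixture u p s :=
      pos_of_mul_pos_right (h0.trans_le (huw.le_mul_mixture hc hp i s)) (inv_pos.mpr hc).le
    rw [← mul_add]
    refine mul_le_mul_of_nonneg_left ?_ h0.le
    have hx : 0 < τ * c⁻¹ := mul_pos hτ0 (inv_pos.mpr hc)
    have hlog := Real.log_le_log hupos (hle s)
    rw [Real.log_mul (by positivity) hwpos.ne'] at hlog
    have hlog1 := Real.log_le_sub_one_of_pos (show 0 < 1 + τ * c⁻¹ by positivity)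
    rw [Real.log_div h0.ne' hwpos.ne', Real.log_div h0.ne' hupos.ne']
    linarith
  calc relEnt σ (p i) (mixture w p)
      ≤ ∫ s, (p i s * Real.log (p i s / mixture u p s) + p i s * (τ * c⁻¹)) ∂σ :=
        integral_mono (hw.integrable_mul_log hc hp i)
          ((huw.integrable_mul_log hc hp i).add ((hp.integrable i).mul_const _)) hpt
    _ = _ := by
        rw [integral_add (huw.integrable_mul_log hc hp i) ((hp.integrable i).mul_const _),
          integral_mul_const, hp.integral, one_mul]
        rfl

/-- A near-optimal input distribution of a channel has an output distribution which is
close, in relative entropy, to every row of the channel. -/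
theorem exists_weight_relEnt_le [Nonempty ι] (hp : IsDensityFamily σ p) {t η : ℝ} (ht0 : 0 < t)
    (ht1 : t < 1) (hη : 0 < η) :
    ∃ w, IsWeight (t / Fintype.card ι) w ∧
      ∀ i, (1 - t) * relEnt σ (p i) (mixture w p) ≤ channelInfo σ p w + η := by
  classical
  have hn : (0 : ℝ) < Fintype.card ι := by exact_mod_cast Fintype.card_pos
  have hn1 : (1 : ℝ) ≤ Fintype.card ι := by exact_mod_cast Fintype.card_pos
  set c : ℝ := t / Fintype.card ι with hcdef
  have hc : 0 < c := div_pos ht0 hn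
  have hc1 : c ≤ 1 := (div_le_one hn).mpr (ht1.le.trans hn1)
  have hcn : Fintype.card ι * c = t := by rw [hcdef]; field_simp
  set V : Set ℝ := channelInfo σ p '' {w | IsWeight c w} with hV
  have hbdd : BddAbove V := ⟨Real.log c⁻¹, by rintro _ ⟨w, hw, rfl⟩; exact hw.channelInfo_le hc hp⟩
  have hne : V.Nonempty := by
    refine ⟨_, fun _ => (Fintype.card ι : ℝ)⁻¹, ⟨fun i => ?_, ?_⟩, rfl⟩
    · rw [hcdef, div_eq_mul_inv]
      exact mul_le_of_le_one_left (inv_pos.mpr hn).le ht1.le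
    · simp
  -- An error `η'` is made twice: in near-optimality and in passing from the mixture of `u` to that
  -- of `w`. The cap `1` ensures `τ ≤ 1`.
  set η' : ℝ := min (η / 2) 1
  have hη' : 0 < η' := lt_min (by positivity) one_pos
  have hη1 : η' ≤ 1 := min_le_right _ _
  have hη2 : η' ≤ η / 2 := min_le_left _ _
  set τ : ℝ := η' * c with hτ
  have hτ0 : 0 < τ := mul_pos hη' hc
  have hτ1 : τ ≤ 1 := mul_le_one₀ hη1 hc.le hc1
  -- The slack is `τ * η'` rather than `η'` because the optimality inequality is divided by `τ` at
  -- the end.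
  obtain ⟨_, ⟨w, hw, rfl⟩, hlt⟩ := exists_lt_of_lt_csSup hne
    (show sSup V - τ * η' < sSup V by linarith [mul_pos hτ0 hη'])
  refine ⟨w, hw, fun i => ?_⟩
  -- The vertex of the truncated simplex at `i`. Moving `w` towards it by `τ` tests near-optimality
  -- against row `i`.
  set v : ι → ℝ := fun j => c + if j = i then 1 - t else 0 with hvdef
  have hv : IsWeight c v := by
    refine ⟨fun j => ?_, ?_⟩
    · simp only [hvdef]
      split_ifs <;> linarith
    · simp [hvdef, Finset.sum_add_distrib, hcn]
  set u : ι → ℝ := fun j => (1 - τ) * w j + τ * v j with hudef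
  have hu : IsWeight c u := by
    refine ⟨fun j => ?_, ?_⟩
    · simp only [hudef]
      nlinarith [hw.le j, hv.le j]
    · simp only [hudef]
      rw [Finset.sum_add_distrib, ← Finset.mul_sum, ← Finset.mul_sum, hw.sum, hv.sum]
      ring
  have h1 : channelInfo σ p u ≤ sSup V := le_csSup hbdd ⟨u, hu, rfl⟩
  have h2 : channelInfo σ p u = (1 - τ) * ∑ j, w j * relEnt σ (p j) (mixture u p)
      + τ * ∑ j, v j * relEnt σ (p j) (mixture u p) := by
    rw [Finset.mul_sum, Finset.mul_sum, ← Finset.sum_add_distrib]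
    exact Finset.sum_congr rfl fun j _ => by simp only [hudef]; ring
  have h3 := hw.channelInfo_le_sum hc hu hp
  have h4 : ∑ j, v j * relEnt σ (p j) (mixture w p) ≤
      ∑ j, v j * relEnt σ (p j) (mixture u p) + τ * c⁻¹ := by
    calc _ ≤ ∑ j, v j * (relEnt σ (p j) (mixture u p) + τ * c⁻¹) :=
          Finset.sum_le_sum fun j _ => mul_le_mul_of_nonneg_left
            (hw.relEnt_le_of_convex hc hv hp hτ0 (fun _ => rfl) hu j) (hv.nonneg hc j)
      _ = _ := by simp_rw [mul_add]; rw [Finset.sum_add_distrib, ← Finset.sum_mul, hv.sum, one_mul]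
  have h5 : (1 - t) * relEnt σ (p i) (mixture w p) ≤
      ∑ j, v j * relEnt σ (p j) (mixture w p) := by
    calc _ ≤ v i * relEnt σ (p i) (mixture w p) :=
          mul_le_mul_of_nonneg_right (by simp [hvdef, hc.le]) (hw.relEnt_nonneg hc hp i)
      _ ≤ _ := Finset.single_le_sum (f := fun j => v j * relEnt σ (p j) (mixture w p))
          (fun j _ => mul_nonneg (hv.nonneg hc j) (hw.relEnt_nonneg hc hp j)) (Finset.mem_univ i)
  have h6 : τ * c⁻¹ = η' := by rw [hτ]; field_simp
  have h7 : τ * ∑ j, v j * relEnt σ (p j) (mixture u p) ≤ τ * (channelInfo σ p w + η') := by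
    have := mul_le_mul_of_nonneg_left h3 (sub_nonneg.mpr hτ1)
    nlinarith
  have h8 := le_of_mul_le_mul_left h7 hτ0
  linarith

end Capacity

/-! ### Greedy rejection sampling -/

section Greedy

set_option linter.unusedSectionVars false

variable {M : Type*} [Fintype M]

/-- Greedy rejection sampling: the sub-distribution of the outcome selected among the first `i`
independent samples of `q`, when the target distribution is `p`. -/
noncomputable def greedy (p q : M → ℝ) : ℕ → M → ℝ
  | 0, _ => 0
  | i + 1, m => min (p m) (greedy p q i m + (1 - ∑ m', greedy p q i m') * q m)

/-- The probability that nothing has been selected after `i` steps. -/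
noncomputable def residual (p q : M → ℝ) (i : ℕ) : ℝ := 1 - ∑ m, greedy p q i m

/-- The probability of accepting the sample `m` in step `i`. -/
noncomputable def accept (p q : M → ℝ) (i : ℕ) (m : M) : ℝ :=
  (greedy p q (i + 1) m - greedy p q i m) / (residual p q i * q m)

/-- The probability of selecting the `i`-th of the samples `ms`. -/
noncomputable def pick (p q : M → ℝ) {N : ℕ} (ms : Fin N → M) : Option (Fin N) → ℝ
  | none => ∏ j : Fin N, (1 - accept p q j (ms j))
  | some i => accept p q i (ms i) * ∏ j : Fin N with j < i, (1 - accept p q j (ms j))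

/-- Either some sample is the first to be accepted or none is; algebraically a telescoping sum,
valid for arbitrary real acceptance values. -/
theorem sum_pick (p q : M → ℝ) {N : ℕ} (ms : Fin N → M) : ∑ o, pick p q ms o = 1 := by
  rw [Fintype.sum_option]
  simp only [pick]
  rw [Finset.prod_one_sub_ordered]
  ring

theorem greedy_succ (p q : M → ℝ) (i : ℕ) (m : M) :
    greedy p q (i + 1) m = min (p m) (greedy p q i m + residual p q i * q m) := rfl

variable {p q : M → ℝ}

theorem greedy_le (hp : ∀ m, 0 ≤ p m) (i : ℕ) (m : M) : greedy p q i m ≤ p m := by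
  cases i with
  | zero => exact hp m
  | succ i => exact min_le_left _ _

theorem residual_nonneg (hp : ∀ m, 0 ≤ p m) (hp1 : ∑ m, p m = 1) (i : ℕ) :
    0 ≤ residual p q i := by
  rw [residual, sub_nonneg, ← hp1]
  exact Finset.sum_le_sum fun m _ => greedy_le hp i m

theorem greedy_le_succ (hp : ∀ m, 0 ≤ p m) (hp1 : ∑ m, p m = 1) (hq : ∀ m, 0 ≤ q m) (i : ℕ)
    (m : M) : greedy p q i m ≤ greedy p q (i + 1) m :=
  le_min (greedy_le hp i m)
    (le_add_of_nonneg_right (mul_nonneg (residual_nonneg hp hp1 i) (hq m)))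

theorem residual_succ_le (hp : ∀ m, 0 ≤ p m) (hp1 : ∑ m, p m = 1) (hq : ∀ m, 0 ≤ q m) (i : ℕ) :
    residual p q (i + 1) ≤ residual p q i :=
  sub_le_sub_left (Finset.sum_le_sum fun m _ => greedy_le_succ hp hp1 hq i m) _

theorem accept_nonneg (hp : ∀ m, 0 ≤ p m) (hp1 : ∑ m, p m = 1) (hq : ∀ m, 0 ≤ q m) (i : ℕ)
    (m : M) : 0 ≤ accept p q i m :=
  div_nonneg (sub_nonneg.mpr (greedy_le_succ hp hp1 hq i m))
    (mul_nonneg (residual_nonneg hp hp1 i) (hq m))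

theorem accept_le_one (hp : ∀ m, 0 ≤ p m) (hp1 : ∑ m, p m = 1) (hq : ∀ m, 0 ≤ q m) (i : ℕ)
    (m : M) : accept p q i m ≤ 1 := by
  refine div_le_one_of_le₀ ?_ (mul_nonneg (residual_nonneg hp hp1 i) (hq m))
  rw [greedy_succ, sub_le_iff_le_add']
  exact min_le_right _ _

theorem pick_nonneg (hp : ∀ m, 0 ≤ p m) (hp1 : ∑ m, p m = 1) (hq : ∀ m, 0 ≤ q m) {N : ℕ}
    (ms : Fin N → M) (o : Option (Fin N)) : 0 ≤ pick p q ms o := by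
  have h : ∀ j m, 0 ≤ 1 - accept p q j m := fun j m =>
    sub_nonneg.mpr (accept_le_one hp hp1 hq j m)
  cases o with
  | none => exact Finset.prod_nonneg fun j _ => h j _
  | some i => exact mul_nonneg (accept_nonneg hp hp1 hq _ _) (Finset.prod_nonneg fun j _ => h j _)

/-- This covers the division by zero in `accept`: if `residual p q i * q m = 0`, the step adds no
mass and both sides vanish. -/
theorem residual_mul_accept (hp : ∀ m, 0 ≤ p m) (i : ℕ) (m : M) :
    residual p q i * (q m * accept p q i m) = greedy p q (i + 1) m - greedy p q i m := by
  rw [← mul_assoc, accept]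
  by_cases h : residual p q i * q m = 0
  · rw [greedy_succ, h, add_zero, min_eq_right (greedy_le hp i m)]
    simp
  · rw [mul_div_cancel₀ _ h]

theorem residual_mul_sum_accept (hp : ∀ m, 0 ≤ p m) (hq1 : ∑ m, q m = 1) (i : ℕ) :
    residual p q i * ∑ m, q m * (1 - accept p q i m) = residual p q (i + 1) := by
  simp_rw [mul_sub, mul_one]
  rw [Finset.sum_sub_distrib, hq1, mul_sub, mul_one, Finset.mul_sum,
    Finset.sum_congr rfl fun m _ => residual_mul_accept hp i m, Finset.sum_sub_distrib]
  simp only [residual]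
  ring

/-- Step `i` multiplies the surviving mass by the probability of rejection. The induction multiplies
and never divides, so a vanishing residual is no special case. -/
theorem prod_sum_accept (hp : ∀ m, 0 ≤ p m) (hq1 : ∑ m, q m = 1) (i : ℕ) :
    ∏ j ∈ Finset.range i, ∑ m, q m * (1 - accept p q j m) = residual p q i := by
  induction i with
  | zero => simp [residual, greedy]
  | succ i ih => rw [Finset.prod_range_succ, ih, residual_mul_sum_accept hp hq1]

theorem sum_prod_mul_pick_none (hp : ∀ m, 0 ≤ p m) (hq1 : ∑ m, q m = 1) (N : ℕ) :
    ∑ ms : Fin N → M, (∏ j, q (ms j)) * pick p q ms none = residual p q N := by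
  classical
  simp only [pick, ← Finset.prod_mul_distrib]
  rw [← prod_sum_accept hp hq1, ← Fin.prod_univ_eq_prod_range
    (fun j => ∑ m, q m * (1 - accept p q j m)) N, Finset.prod_univ_sum, Fintype.piFinset_univ]

/-- The summand factors over the samples: those before `i` contribute the residual, those after `i`
sum out to one, and the residual times the acceptance at `i` is the increment of `greedy`. -/
theorem sum_prod_mul_pick_some (hp : ∀ m, 0 ≤ p m) (hq1 : ∑ m, q m = 1) {N : ℕ} (i : Fin N)
    (h : M → ℝ) :
    ∑ ms : Fin N → M, (∏ j, q (ms j)) * (pick p q ms (some i) * h (ms i)) =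
      ∑ m, (greedy p q (i + 1) m - greedy p q i m) * h m := by
  classical
  set b : Fin N → M → ℝ := fun j m =>
    (if j < i then 1 - accept p q j m else 1) * (if j = i then accept p q j m * h m else 1)
    with hb
  have h1 : ∀ ms : Fin N → M, (∏ j, q (ms j)) * (pick p q ms (some i) * h (ms i)) =
      ∏ j, q (ms j) * b j (ms j) := by
    intro ms
    simp only [hb, pick]
    rw [Finset.prod_mul_distrib, Finset.prod_mul_distrib, Finset.prod_ite_eq' Finset.univ i
      (fun j => accept p q j (ms j) * h (ms j)), ← Finset.prod_filter]
    simp only [Finset.mem_univ, if_true]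
    ring
  have h2 : ∀ j : Fin N, ∑ m, q m * b j m =
      (if j < i then ∑ m, q m * (1 - accept p q j m) else 1) *
        (if j = i then ∑ m, q m * accept p q i m * h m else 1) := by
    intro j
    rcases lt_trichotomy j i with hj | hj | hj
    · simp [hb, hj, hj.ne]
    · subst hj
      simp [hb, mul_assoc]
    · simp [hb, hj.not_gt, hj.ne', hq1]
  have h3 : ∏ j : Fin N, (if j < i then ∑ m, q m * (1 - accept p q j m) else 1) =
      residual p q i := by
    rw [← prod_sum_accept hp hq1]
    have := Fin.prod_univ_eq_prod_range
      (fun j => if j < (i : ℕ) then ∑ m, q m * (1 - accept p q j m) else 1) N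
    simp only [Fin.lt_def]
    rw [this, ← Finset.prod_filter]
    refine Finset.prod_congr ?_ fun _ _ => rfl
    ext j
    simp only [Finset.mem_filter, Finset.mem_range]
    exact ⟨fun h => h.2, fun h => ⟨h.trans i.2, h⟩⟩
  have h4 : ∑ ms : Fin N → M, ∏ j, q (ms j) * b j (ms j) = ∏ j, ∑ m, q m * b j m := by
    rw [Finset.prod_univ_sum, Fintype.piFinset_univ]
  rw [Finset.sum_congr rfl fun ms _ => h1 ms, h4, Finset.prod_congr rfl fun j _ => h2 j,
    Finset.prod_mul_distrib, h3,
    Finset.prod_ite_eq' Finset.univ i]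
  simp only [Finset.mem_univ, if_true]
  rw [Finset.mul_sum]
  exact Finset.sum_congr rfl fun m _ => by rw [← mul_assoc, residual_mul_accept hp]

theorem sum_prod_mul_sum_pick (hp : ∀ m, 0 ≤ p m) (hq1 : ∑ m, q m = 1) (N : ℕ) (h : M → ℝ) :
    ∑ ms : Fin N → M, (∏ j, q (ms j)) * ∑ i, pick p q ms (some i) * h (ms i) =
      ∑ m, greedy p q N m * h m := by
  simp_rw [Finset.mul_sum]
  rw [Finset.sum_comm, Finset.sum_congr rfl fun i _ => sum_prod_mul_pick_some hp hq1 i h,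
    Finset.sum_comm]
  refine Finset.sum_congr rfl fun m _ => ?_
  rw [← Finset.sum_mul, Fin.sum_univ_eq_sum_range (fun i => greedy p q (i + 1) m - greedy p q i m),
    Finset.sum_range_sub (fun i => greedy p q i m)]
  simp [greedy]

/-- An outcome not yet saturated has gained `residual p q j * q m` at every step `j < i`, and the
residuals decrease. -/
theorem mul_residual_le_greedy (hp : ∀ m, 0 ≤ p m) (hp1 : ∑ m, p m = 1) (hq : ∀ m, 0 ≤ q m)
    (i : ℕ) (m : M) (h : greedy p q i m < p m) :
    i * residual p q i * q m ≤ greedy p q i m := by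
  induction i with
  | zero => simp [greedy]
  | succ i ih =>
    have h1 := ih ((greedy_le_succ hp hp1 hq i m).trans_lt h)
    have h2 : greedy p q (i + 1) m = greedy p q i m + residual p q i * q m := by
      rw [greedy_succ] at h ⊢
      refine min_eq_right (le_of_lt ?_)
      by_contra! hle
      rw [min_eq_left hle] at h
      exact lt_irrefl _ h
    have h3 := mul_le_mul_of_nonneg_right (residual_succ_le hp hp1 hq i) (hq m)
    have h4 := mul_le_mul_of_nonneg_left h3 (show (0 : ℝ) ≤ i + 1 by positivity)
    rw [h2]
    push_cast
    nlinarith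

/-- Greedy rejection sampling with `N` samples fails with probability at most about
`D(p ‖ q) / log N`. -/
theorem residual_mul_log_le (hp : ∀ m, 0 ≤ p m) (hp1 : ∑ m, p m = 1) (hq : ∀ m, 0 ≤ q m)
    (hq1 : ∑ m, q m = 1) (hpq : ∀ m, q m = 0 → p m = 0) {N : ℕ} (hN : 0 < N) :
    residual p q N * Real.log N ≤ ∑ m, p m * Real.log (p m / q m) + 2 := by
  set s := residual p q N with hs
  have hN' : (0 : ℝ) < N := by exact_mod_cast hN
  have hs0 : 0 ≤ s := residual_nonneg hp hp1 N
  have hterm : ∀ m, p m ≤ p m * Real.log (p m / q m) + q m := fun m => by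
    linarith [sub_le_mul_log_div (hp m) (hq m) (hpq m)]
  rcases hs0.eq_or_lt with h0 | h0
  · rw [← h0, zero_mul]
    have := Finset.sum_le_sum fun m (_ : m ∈ Finset.univ) => hterm m
    rw [Finset.sum_add_distrib, hp1, hq1] at this
    linarith
  -- Summed over `m`, the left side is `s * log (N * s)`. For unsaturated `m`, `N * s * q m ≤ p m`
  -- bounds the logarithm by `log (p m / q m)`; otherwise the left side is at most zero and the
  -- right side is nonnegative.
  have hpt : ∀ m, (p m - greedy p q N m) * Real.log (N * s) ≤
      p m * Real.log (p m / q m) + q m := by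
    intro m
    rcases (greedy_le hp N m : greedy p q N m ≤ p m).eq_or_lt with h | h
    · rw [h, sub_self, zero_mul]
      exact (hp m).trans (hterm m)
    have hG : 0 ≤ greedy p q N m :=
      (mul_nonneg (mul_nonneg hN'.le hs0) (hq m)).trans (mul_residual_le_greedy hp hp1 hq N m h)
    have hpm : 0 < p m := hG.trans_lt h
    have hqm : 0 < q m := (hq m).lt_of_ne' fun h' => hpm.ne' (hpq m h')
    rcases le_or_gt (Real.log (N * s)) 0 with hl | hl
    · exact (mul_nonpos_of_nonneg_of_nonpos (sub_nonneg.mpr h.le) hl).trans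
        ((hp m).trans (hterm m))
    have hle : Real.log (N * s) ≤ Real.log (p m / q m) := by
      refine Real.log_le_log (mul_pos hN' h0) ?_
      rw [le_div_iff₀ hqm]
      exact (mul_residual_le_greedy hp hp1 hq N m h).trans h.le
    have h1 : (p m - greedy p q N m) * Real.log (N * s) ≤ p m * Real.log (N * s) :=
      mul_le_mul_of_nonneg_right (by linarith) hl.le
    have h2 := mul_le_mul_of_nonneg_left hle hpm.le
    linarith
  have hsum := Finset.sum_le_sum fun m (_ : m ∈ Finset.univ) => hpt m
  rw [← Finset.sum_mul, Finset.sum_sub_distrib, Finset.sum_add_distrib, hp1, hq1] at hsum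
  change s * Real.log (N * s) ≤ _ at hsum
  rw [Real.log_mul hN'.ne' h0.ne'] at hsum
  -- `s - 1 ≤ s * log s` removes `s` from the logarithm. This and `∑ m, q m = 1` account for the
  -- constant `2`.
  have h3 := sub_le_mul_log_div hs0 zero_le_one (by simp)
  rw [div_one] at h3
  linarith

end Greedy

/-! ### Rejection sampling in the presence of a shared string -/

section Measurability

variable {M R : Type*} [Fintype M] [MeasurableSpace R] {p q : M → R → ℝ}

theorem measurable_greedy (hp : ∀ m, Measurable (p m)) (hq : ∀ m, Measurable (q m)) (i : ℕ)
    (m : M) : Measurable fun r => greedy (fun m => p m r) (fun m => q m r) i m := by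
  induction i generalizing m with
  | zero => exact measurable_const
  | succ i ih =>
    simp only [greedy_succ, residual]
    exact (hp m).min ((ih m).add ((measurable_const.sub
      (Finset.measurable_sum _ fun m _ => ih m)).mul (hq m)))

theorem measurable_residual (hp : ∀ m, Measurable (p m)) (hq : ∀ m, Measurable (q m)) (i : ℕ) :
    Measurable fun r => residual (fun m => p m r) (fun m => q m r) i :=
  measurable_const.sub (Finset.measurable_sum _ fun m _ => measurable_greedy hp hq i m)

theorem measurable_accept (hp : ∀ m, Measurable (p m)) (hq : ∀ m, Measurable (q m)) (i : ℕ)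
    (m : M) : Measurable fun r => accept (fun m => p m r) (fun m => q m r) i m :=
  ((measurable_greedy hp hq (i + 1) m).sub (measurable_greedy hp hq i m)).div
    ((measurable_residual hp hq i).mul (hq m))

theorem measurable_pick (hp : ∀ m, Measurable (p m)) (hq : ∀ m, Measurable (q m)) {N : ℕ}
    (ms : Fin N → M) (o : Option (Fin N)) :
    Measurable fun r => pick (fun m => p m r) (fun m => q m r) ms o := by
  have h : ∀ j m, Measurable fun r => 1 - accept (fun m => p m r) (fun m => q m r) j m :=
    fun j m => measurable_const.sub (measurable_accept hp hq j m)
  cases o with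
  | none => exact Finset.measurable_prod _ fun j _ => h j (ms j)
  | some i => exact (measurable_accept hp hq _ _).mul (Finset.measurable_prod _ fun j _ => h j _)

end Measurability

theorem integral_count_prod {M R : Type*} [Fintype M] [MeasurableSpace M]
    [DiscreteMeasurableSpace M] [MeasurableSpace R] {ρ : Measure R} [SFinite ρ]
    {F : M × R → ℝ} (hF : Integrable F (Measure.count.prod ρ)) :
    ∫ s, F s ∂(Measure.count.prod ρ) = ∫ r, ∑ m, F (m, r) ∂ρ := by
  rw [integral_prod_symm _ hF]
  refine integral_congr_ae (Filter.Eventually.of_forall fun r => ?_)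
  simp only []
  rw [integral_fintype Integrable.of_finite]
  simp

section Seed

set_option linter.unusedSectionVars false

variable {M R : Type*} [Fintype M] [MeasurableSpace M] [DiscreteMeasurableSpace M]
  [MeasurableSpace R]

/-- The law of a random string `r` of law `ρ` together with `N` conditionally independent samples
of the distribution `q (·, r)`. -/
noncomputable def seedMeasure (ρ : Measure R) (q : M × R → ℝ) (N : ℕ) :
    Measure (R × (Fin N → M)) :=
  (ρ.prod Measure.count).withDensity fun a => ENNReal.ofReal (∏ j, q (a.2 j, a.1))

variable {ρ : Measure R} [IsProbabilityMeasure ρ] {q : M × R → ℝ}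

theorem lintegral_seedMeasure (hq : Measurable q) {N : ℕ} {F : R × (Fin N → M) → ℝ≥0∞}
    (hF : Measurable F) :
    ∫⁻ a, F a ∂(seedMeasure ρ q N) =
      ∫⁻ r, ∑ ms, ENNReal.ofReal (∏ j, q (ms j, r)) * F (r, ms) ∂ρ := by
  have hd : Measurable fun a : R × (Fin N → M) => ENNReal.ofReal (∏ j, q (a.2 j, a.1)) := by
    fun_prop
  rw [seedMeasure, lintegral_withDensity_eq_lintegral_mul _ hd hF,
    lintegral_prod _ (hd.mul hF).aemeasurable]
  refine lintegral_congr fun r => ?_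
  rw [lintegral_count, tsum_fintype]
  rfl

theorem isProbabilityMeasure_seedMeasure (hq : Measurable q) (hq0 : ∀ s, 0 ≤ q s)
    (hq1 : ∀ r, ∑ m, q (m, r) = 1) (N : ℕ) : IsProbabilityMeasure (seedMeasure ρ q N) := by
  classical
  refine ⟨?_⟩
  rw [← lintegral_one, lintegral_seedMeasure hq measurable_const]
  have h : ∀ r, ∑ ms : Fin N → M, ENNReal.ofReal (∏ j, q (ms j, r)) * 1 = 1 := by
    intro r
    simp_rw [mul_one]
    rw [← ENNReal.ofReal_sum_of_nonneg fun ms _ => Finset.prod_nonneg fun j _ => hq0 _,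
      ← Fintype.piFinset_univ, ← Finset.prod_univ_sum (fun _ => Finset.univ)
        fun (_ : Fin N) m => q (m, r)]
    simp [hq1]
  simp only [h]
  simp

variable {p : M × R → ℝ}

theorem measurable_pick_seed (hp : Measurable p) (hq : Measurable q) {N : ℕ}
    (o : Option (Fin N)) : Measurable fun a : R × (Fin N → M) =>
      pick (fun m => p (m, a.1)) (fun m => q (m, a.1)) a.2 o :=
  measurable_from_prod_countable_left fun ms =>
    measurable_pick (p := fun m r => p (m, r)) (q := fun m r => q (m, r))
      (fun m => hp.comp (by fun_prop)) (fun m => hq.comp (by fun_prop)) ms o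

/-- Given `r`, the selected sample is `m` with probability `greedy P Q N m ≤ p (m, r)`. Hence
simulating a message does not increase the expectation of a nonnegative `h`, in particular an error
probability. -/
theorem lintegral_pick_some_le (hp : Measurable p) (hq : Measurable q) (hp0 : ∀ s, 0 ≤ p s)
    (hp1 : ∀ r, ∑ m, p (m, r) = 1) (hq0 : ∀ s, 0 ≤ q s) (hq1 : ∀ r, ∑ m, q (m, r) = 1) {N : ℕ}
    {h : M × R → ℝ≥0∞} (hh : Measurable h) :
    ∫⁻ a, ∑ i, ENNReal.ofReal (pick (fun m => p (m, a.1)) (fun m => q (m, a.1)) a.2 (some i)) *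
      h (a.2 i, a.1) ∂(seedMeasure ρ q N) ≤ ∫⁻ r, ∑ m, ENNReal.ofReal (p (m, r)) * h (m, r) ∂ρ := by
  classical
  have hmeas : ∀ i : Fin N, Measurable fun a : R × (Fin N → M) => h (a.2 i, a.1) :=
    fun i => hh.comp (by fun_prop)
  have hpick : ∀ i : Fin N, Measurable fun a : R × (Fin N → M) =>
      ENNReal.ofReal (pick (fun m => p (m, a.1)) (fun m => q (m, a.1)) a.2 (some i)) :=
    fun i => (measurable_pick_seed hp hq _).ennreal_ofReal
  rw [lintegral_seedMeasure hq (by fun_prop)]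
  refine lintegral_mono fun r => ?_
  set P : M → ℝ := fun m => p (m, r)
  set Q : M → ℝ := fun m => q (m, r)
  have hP : ∀ m, 0 ≤ P m := fun m => hp0 _
  have hQ : ∀ m, 0 ≤ Q m := fun m => hq0 _
  have hQ1 : ∑ m, Q m = 1 := hq1 r
  have hpk : ∀ (ms : Fin N → M) o, 0 ≤ pick P Q ms o := pick_nonneg hP (hp1 r) hQ
  have hpr : ∀ ms : Fin N → M, 0 ≤ ∏ j, Q (ms j) := fun ms => Finset.prod_nonneg fun j _ => hQ _
  change ∑ ms : Fin N → M, ENNReal.ofReal (∏ j, Q (ms j)) *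
    ∑ i, ENNReal.ofReal (pick P Q ms (some i)) * h (ms i, r) ≤ ∑ m, ENNReal.ofReal (P m) * h (m, r)
  -- Grouping by the value `m` of the selected sample separates the real weights, to which
  -- `sum_prod_mul_sum_pick` applies, from the extended values of `h`.
  calc _ = ∑ ms : Fin N → M, ∑ m, (ENNReal.ofReal ((∏ j, Q (ms j)) *
        ∑ i, pick P Q ms (some i) * if ms i = m then 1 else 0)) * h (m, r) := by
        refine Finset.sum_congr rfl fun ms _ => ?_
        have h1 : ∀ m, ENNReal.ofReal ((∏ j, Q (ms j)) *
            ∑ i, pick P Q ms (some i) * if ms i = m then 1 else 0) * h (m, r) =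
            ENNReal.ofReal (∏ j, Q (ms j)) * ∑ i, if ms i = m then
              ENNReal.ofReal (pick P Q ms (some i)) * h (m, r) else 0 := by
          intro m
          rw [ENNReal.ofReal_mul (hpr ms), ENNReal.ofReal_sum_of_nonneg fun i _ =>
            mul_nonneg (hpk ms _) (by positivity), mul_assoc, Finset.sum_mul]
          congr 1
          refine Finset.sum_congr rfl fun i _ => ?_
          split_ifs <;> simp
        rw [Finset.sum_congr rfl fun m _ => h1 m, ← Finset.mul_sum, Finset.sum_comm]
        congr 1
        exact Finset.sum_congr rfl fun i _ => by simp
    _ = ∑ m, ENNReal.ofReal (greedy P Q N m) * h (m, r) := by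
        rw [Finset.sum_comm]
        refine Finset.sum_congr rfl fun m _ => ?_
        rw [← Finset.sum_mul, ← ENNReal.ofReal_sum_of_nonneg,
          sum_prod_mul_sum_pick hP hQ1 N fun m' => if m' = m then 1 else 0]
        · simp
        · exact fun ms _ => mul_nonneg (hpr ms) (Finset.sum_nonneg fun i _ =>
            mul_nonneg (hpk ms _) (by positivity))
    _ ≤ _ := Finset.sum_le_sum fun m _ => by
        gcongr
        exact greedy_le hP N m

/-- `residual_mul_log_le` applies for each fixed `r`. The conditional divergences average to
`relEnt`, since `p` and `q` are conditional densities over the same law `ρ` of `r`. -/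
theorem lintegral_pick_none_le (hp : Measurable p) (hq : Measurable q) (hp0 : ∀ s, 0 ≤ p s)
    (hp1 : ∀ r, ∑ m, p (m, r) = 1) (hq0 : ∀ s, 0 ≤ q s) (hq1 : ∀ r, ∑ m, q (m, r) = 1) {K : ℝ}
    (hpq : ∀ s, p s ≤ K * q s) {N : ℕ} (hN : 2 ≤ N) :
    ∫⁻ a, ENNReal.ofReal (pick (fun m => p (m, a.1)) (fun m => q (m, a.1)) a.2 none)
      ∂(seedMeasure ρ q N) ≤
        ENNReal.ofReal ((relEnt (Measure.count.prod ρ) p q + 2) / Real.log N) := by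
  have hlog : 0 < Real.log N := Real.log_pos (by exact_mod_cast hN)
  have le_one_of : ∀ {u : M × R → ℝ}, (∀ s, 0 ≤ u s) → (∀ r, ∑ m, u (m, r) = 1) → ∀ s, u s ≤ 1 := by
    rintro u h0 h1 ⟨m, r⟩
    rw [← h1 r]
    exact Finset.single_le_sum (f := fun m => u (m, r)) (fun m _ => h0 _) (Finset.mem_univ m)
  have hintg := integrable_mul_log_div (σ := (Measure.count : Measure M).prod ρ) hp hq hp0
    (le_one_of hp0 hp1) hq0 (le_one_of hq0 hq1) hpq
  have hintg' : Integrable (fun r => ∑ m, p (m, r) * Real.log (p (m, r) / q (m, r))) ρ := by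
    have := hintg.integral_prod_right
    refine this.congr (Filter.Eventually.of_forall fun r => ?_)
    simp only []
    rw [integral_fintype Integrable.of_finite]
    simp
  have hres : ∀ r, residual (fun m => p (m, r)) (fun m => q (m, r)) N ≤
      (∑ m, p (m, r) * Real.log (p (m, r) / q (m, r)) + 2) / Real.log N := by
    intro r
    rw [le_div_iff₀ hlog]
    refine residual_mul_log_le (fun m => hp0 _) (hp1 r) (fun m => hq0 _) (hq1 r) (fun m h0 => ?_)
      (by lia)
    have := hpq (m, r)
    rw [h0, mul_zero] at this
    exact le_antisymm this (hp0 _)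
  calc _ = ∫⁻ r, ENNReal.ofReal (residual (fun m => p (m, r)) (fun m => q (m, r)) N) ∂ρ := by
        rw [lintegral_seedMeasure hq (measurable_pick_seed hp hq _).ennreal_ofReal]
        refine lintegral_congr fun r => ?_
        rw [← sum_prod_mul_pick_none (fun m => hp0 _) (hq1 r), ENNReal.ofReal_sum_of_nonneg]
        · exact Finset.sum_congr rfl fun ms _ =>
            (ENNReal.ofReal_mul (Finset.prod_nonneg fun j _ => hq0 _)).symm
        · exact fun ms _ => mul_nonneg (Finset.prod_nonneg fun j _ => hq0 _)
            (pick_nonneg (fun m => hp0 _) (hp1 r) (fun m => hq0 _) _ _)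
    _ ≤ ∫⁻ r, ENNReal.ofReal
        ((∑ m, p (m, r) * Real.log (p (m, r) / q (m, r)) + 2) / Real.log N) ∂ρ :=
        lintegral_mono fun r => ENNReal.ofReal_le_ofReal (hres r)
    _ = _ := by
        have hadd : Integrable (fun r =>
            (∑ m, p (m, r) * Real.log (p (m, r) / q (m, r)) + 2) / Real.log N) ρ :=
          (hintg'.add (integrable_const 2)).div_const _
        rw [← ofReal_integral_eq_lintegral_ofReal hadd
          (Filter.Eventually.of_forall fun r => (residual_nonneg (fun m => hp0 _) (hp1 r) N).trans
            (hres r)), integral_div]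
        congr 2
        rw [integral_add hintg' (integrable_const 2), relEnt, integral_count_prod hintg]
        simp

end Seed

/-! ### Densities of the messages and of the referee's view -/

section MsgDensity

set_option linter.unusedSectionVars false

variable {X A R M : Type*} [MeasurableSpace A] [MeasurableSpace R] [Fintype M] [MeasurableSpace M]
  [DiscreteMeasurableSpace M] (κ : Measure A) [IsProbabilityMeasure κ] {msg : X → A × R → M}

/-- The conditional probability, given the shared string `s.2`, that the message is `s.1`. -/
noncomputable def msgDensity (msg : X → A × R → M) (x : X) (s : M × R) : ℝ :=
  κ.real {a | msg x (a, s.2) = s.1}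

theorem msgDensity_nonneg (msg : X → A × R → M) (x : X) (s : M × R) :
    0 ≤ msgDensity κ msg x s := measureReal_nonneg

theorem lintegral_msg (hmsg : ∀ x, Measurable (msg x)) (x : X) (r : R) (F : M → ℝ≥0∞) :
    ∫⁻ a, F (msg x (a, r)) ∂κ = ∑ m, ENNReal.ofReal (msgDensity κ msg x (m, r)) * F m := by
  have hm : Measurable fun a => msg x (a, r) := (hmsg x).comp (by fun_prop)
  rw [← lintegral_map (f := F) (.of_discrete) hm, lintegral_fintype]
  refine Finset.sum_congr rfl fun m _ => ?_
  rw [Measure.map_apply hm (measurableSet_singleton m), mul_comm, msgDensity, ofReal_measureReal]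
  rfl

theorem sum_msgDensity (hmsg : ∀ x, Measurable (msg x)) (x : X) (r : R) :
    ∑ m, msgDensity κ msg x (m, r) = 1 := by
  have h := lintegral_msg κ hmsg x r fun _ => 1
  simp only [lintegral_one, measure_univ, mul_one] at h
  rw [← ENNReal.ofReal_sum_of_nonneg fun m _ => msgDensity_nonneg κ msg x _] at h
  exact ENNReal.ofReal_eq_one.mp h.symm

theorem measurable_msgDensity (hmsg : ∀ x, Measurable (msg x)) (x : X) :
    Measurable (msgDensity κ msg x) := by
  refine measurable_from_prod_countable_right fun m => ?_
  exact (measurable_measure_prodMk_right (hmsg x (measurableSet_singleton m))).ennreal_toReal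

theorem isDensityFamily_msgDensity (ρ : Measure R) [IsProbabilityMeasure ρ]
    (hmsg : ∀ x, Measurable (msg x)) :
    IsDensityFamily (Measure.count.prod ρ) (msgDensity κ msg) where
  measurable := measurable_msgDensity κ hmsg
  nonneg _ _ := measureReal_nonneg
  le_one _ _ := measureReal_le_one
  integral x := by
    rw [integral_count_prod]
    · simp [sum_msgDensity κ hmsg]
    · exact Integrable.of_bound (C := 1) (measurable_msgDensity κ hmsg x).aestronglyMeasurable
        (Filter.Eventually.of_forall fun s => by
          rw [Real.norm_of_nonneg (msgDensity_nonneg κ msg x s)]; exact measureReal_le_one)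

end MsgDensity

namespace SharedProtocol

variable {X Y : Type*} (P : SharedProtocol X Y)

/-- Conditional distribution of Alice's message given the string shared with the referee. -/
noncomputable abbrev densA : X → P.MA × P.RAC → ℝ := msgDensity P.lawA P.msgA

/-- Conditional distribution of Bob's message given the string shared with the referee. -/
noncomputable abbrev densB : Y → P.MB × P.RBC → ℝ := msgDensity P.lawB P.msgB

/-- The joint law of the random strings known to the referee. -/
noncomputable abbrev lawRef : Measure (P.RC × P.RAC × P.RBC) :=
  P.lawC.prod (P.lawAC.prod P.lawBC)

/-- The reference measure on the views. -/
noncomputable abbrev base : Measure P.View :=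
  Measure.count.prod (Measure.count.prod P.lawRef)

theorem isDensityFamily_densA : IsDensityFamily (Measure.count.prod P.lawAC) P.densA :=
  isDensityFamily_msgDensity _ _ P.measurable_msgA

theorem isDensityFamily_densB : IsDensityFamily (Measure.count.prod P.lawBC) P.densB :=
  isDensityFamily_msgDensity _ _ P.measurable_msgB

theorem measurable_view (z : X × Y) : Measurable (P.view z) := by
  have hA := P.measurable_msgA z.1
  have hB := P.measurable_msgB z.2
  unfold view
  exact (hA.comp (by fun_prop)).prodMk ((hB.comp (by fun_prop)).prodMk (by fun_prop))

theorem lintegral_base {F : P.View → ℝ≥0∞} (hF : Measurable F) :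
    ∫⁻ v, F v ∂P.base = ∫⁻ c, ∑ m, ∑ m', F (m, m', c) ∂P.lawRef := by
  rw [lintegral_prod_symm' _ hF, lintegral_prod_symm' _ (Measurable.lintegral_prod_left' hF)]
  refine lintegral_congr fun c => ?_
  rw [lintegral_count, tsum_fintype, Finset.sum_comm]
  refine Finset.sum_congr rfl fun m' _ => ?_
  rw [lintegral_count, tsum_fintype]

/-- Given the referee's strings, each message depends only on its sender's private string, so the
two messages are conditionally independent. -/
theorem lintegral_view {F : P.View → ℝ≥0∞} (hF : Measurable F) (x : X) (y : Y) :
    ∫⁻ r, F (P.view (x, y) r) ∂P.law = ∫⁻ c, ∑ m, ENNReal.ofReal (P.densA x (m, c.2.1)) *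
      ∑ m', ENNReal.ofReal (P.densB y (m', c.2.2)) * F (m, m', c) ∂P.lawRef := by
  have h1 : Measurable fun r => F (P.view (x, y) r) := hF.comp (P.measurable_view _)
  unfold law
  rw [lintegral_prod_symm' _ h1, lintegral_prod_symm' _ (Measurable.lintegral_prod_left' h1)]
  refine lintegral_congr fun c => ?_
  have h2 : ∀ b, ∫⁻ a, F (P.view (x, y) (a, b, c)) ∂P.lawA =
      ∑ m, ENNReal.ofReal (P.densA x (m, c.2.1)) * F (m, P.msgB y (b, c.2.2), c) := fun b =>
    lintegral_msg P.lawA P.measurable_msgA x c.2.1 fun m => F (m, P.msgB y (b, c.2.2), c)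
  simp_rw [h2]
  have hmB : Measurable fun b => P.msgB y (b, c.2.2) := (P.measurable_msgB y).comp (by fun_prop)
  rw [lintegral_finsetSum _ fun m _ => by fun_prop]
  refine Finset.sum_congr rfl fun m _ => ?_
  rw [lintegral_const_mul _ (by fun_prop)]
  congr 1
  exact lintegral_msg P.lawB P.measurable_msgB y c.2.2 fun m' => F (m, m', c)

/-- The density of the view on input `z`. -/
noncomputable def viewDensity (z : X × Y) (v : P.View) : ℝ :=
  P.densA z.1 (v.1, v.2.2.2.1) * P.densB z.2 (v.2.1, v.2.2.2.2)

theorem measurable_viewDensity (z : X × Y) : Measurable (P.viewDensity z) :=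
  ((P.isDensityFamily_densA.measurable z.1).comp (by fun_prop)).mul
    ((P.isDensityFamily_densB.measurable z.2).comp (by fun_prop))

theorem lintegral_view_eq_base {F : P.View → ℝ≥0∞} (hF : Measurable F) (z : X × Y) :
    ∫⁻ r, F (P.view z r) ∂P.law = ∫⁻ v, ENNReal.ofReal (P.viewDensity z v) * F v ∂P.base := by
  have hd := P.measurable_viewDensity z
  rw [P.lintegral_base (by fun_prop), ← Prod.mk.eta (p := z), P.lintegral_view hF]
  refine lintegral_congr fun c => ?_
  refine Finset.sum_congr rfl fun m _ => ?_
  rw [Finset.mul_sum]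
  refine Finset.sum_congr rfl fun m' _ => ?_
  rw [viewDensity, ENNReal.ofReal_mul (msgDensity_nonneg _ _ _ _), mul_assoc]

theorem integral_base_mul {a : P.MA × P.RAC → ℝ} {b : P.MB × P.RBC → ℝ}
    (ha : Integrable a (Measure.count.prod P.lawAC))
    (hb : Integrable b (Measure.count.prod P.lawBC))
    (hab : Integrable (fun v : P.View => a (v.1, v.2.2.2.1) * b (v.2.1, v.2.2.2.2)) P.base) :
    ∫ v, a (v.1, v.2.2.2.1) * b (v.2.1, v.2.2.2.2) ∂P.base =
      (∫ s, a s ∂(Measure.count.prod P.lawAC)) * ∫ s, b s ∂(Measure.count.prod P.lawBC) := by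
  have hsum : ∀ {M R : Type} [Fintype M] [MeasurableSpace M] [DiscreteMeasurableSpace M]
      [MeasurableSpace R] {ρ : Measure R} [SFinite ρ] {F : M × R → ℝ}
      (_ : Integrable F (Measure.count.prod ρ)),
      ∫ s, F s ∂(Measure.count.prod ρ) = ∑ m, ∫ r, F (m, r) ∂ρ := by
    intro M R _ _ _ _ ρ _ F hF
    rw [integral_prod _ hF, integral_fintype Integrable.of_finite]
    simp
  have hm : ∀ m, Integrable (fun u : P.MB × P.RC × P.RAC × P.RBC =>
      a (m, u.2.2.1) * b (u.1, u.2.2.2)) (Measure.count.prod P.lawRef) := by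
    intro m
    have := hab.prod_right_ae
    rw [Measure.ae_count_iff] at this
    exact this m
  rw [hsum hab, hsum ha, hsum hb, Finset.sum_mul_sum]
  refine Finset.sum_congr rfl fun m _ => ?_
  rw [hsum (hm m)]
  refine Finset.sum_congr rfl fun m' _ => ?_
  have h1 := integral_fun_snd (μ := P.lawC) (ν := P.lawAC.prod P.lawBC)
    fun c : P.RAC × P.RBC => a (m, c.1) * b (m', c.2)
  rw [probReal_univ, one_smul] at h1
  rw [← integral_prod_mul]
  exact h1

end SharedProtocol

/-- The discrete measure with weights `w`. -/
noncomputable def weightMeasure {Z : Type*} [Fintype Z] [MeasurableSpace Z] (w : Z → ℝ) :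
    Measure Z :=
  ∑ z, ENNReal.ofReal (w z) • Measure.dirac z

section WeightMeasure

set_option linter.unusedSectionVars false

variable {Z : Type*} [Fintype Z] [MeasurableSpace Z] [DiscreteMeasurableSpace Z] {w : Z → ℝ}

theorem weightMeasure_singleton (w : Z → ℝ) (z : Z) :
    weightMeasure w {z} = ENNReal.ofReal (w z) := by
  classical
  simp [weightMeasure, Measure.finsetSum_apply, Set.indicator_apply]

theorem isProbabilityMeasure_weightMeasure (h0 : ∀ z, 0 ≤ w z) (h1 : ∑ z, w z = 1) :
    IsProbabilityMeasure (weightMeasure w) := by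
  refine ⟨?_⟩
  simp [weightMeasure, Measure.finsetSum_apply, ← ENNReal.ofReal_sum_of_nonneg fun z _ => h0 z, h1]

end WeightMeasure

/-! ### Leakage on independent inputs -/

namespace SharedProtocol

set_option linter.unusedSectionVars false

variable {X Y : Type*} [Fintype X] [Fintype Y] [MeasurableSpace X] [MeasurableSpace Y]
  [DiscreteMeasurableSpace X] [DiscreteMeasurableSpace Y] (P : SharedProtocol X Y)

theorem measurable_uncurry_view :
    Measurable fun ω : (X × Y) × P.Rand => P.view ω.1 ω.2 :=
  measurable_from_prod_countable_right fun z => P.measurable_view z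

theorem measurable_uncurry_viewDensity :
    Measurable fun ω : (X × Y) × P.View => P.viewDensity ω.1 ω.2 :=
  measurable_from_prod_countable_right fun z => P.measurable_viewDensity z

theorem map_view_joint (μ : Measure (X × Y)) [IsProbabilityMeasure μ] :
    (μ.prod P.law).map (fun ω => (ω.1, P.view ω.1 ω.2)) =
      (μ.prod P.base).withDensity fun ω => ENNReal.ofReal (P.viewDensity ω.1 ω.2) := by
  refine Measure.ext_of_lintegral _ fun F hF => ?_
  have hv := P.measurable_uncurry_view
  have hd := P.measurable_uncurry_viewDensity
  have hd' : Measurable fun ω : (X × Y) × P.View =>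
      ENNReal.ofReal (P.viewDensity ω.1 ω.2) * F ω := by fun_prop
  rw [lintegral_map hF (measurable_fst.prodMk hv), lintegral_prod _ (by fun_prop),
    lintegral_withDensity_eq_lintegral_mul _ (by fun_prop) hF, lintegral_prod _ (by fun_prop)]
  refine lintegral_congr fun z => ?_
  exact P.lintegral_view_eq_base (F := fun v => F (z, v)) (by fun_prop) z

variable {wA : X → ℝ} {wB : Y → ℝ} {cA cB : ℝ}

/-- The density of the view when the inputs are drawn with weights `wA` and `wB`. -/
noncomputable def mixedDensity (wA : X → ℝ) (wB : Y → ℝ) (v : P.View) : ℝ :=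
  mixture wA P.densA (v.1, v.2.2.2.1) * mixture wB P.densB (v.2.1, v.2.2.2.2)

theorem measurable_mixedDensity (wA : X → ℝ) (wB : Y → ℝ) :
    Measurable (P.mixedDensity wA wB) :=
  ((P.isDensityFamily_densA.measurable_mixture wA).comp (by fun_prop)).mul
    ((P.isDensityFamily_densB.measurable_mixture wB).comp (by fun_prop))

theorem mixedDensity_nonneg (hcA : 0 < cA) (hcB : 0 < cB) (hA : IsWeight cA wA)
    (hB : IsWeight cB wB) (v : P.View) : 0 ≤ P.mixedDensity wA wB v :=
  mul_nonneg (hA.mixture_nonneg hcA P.isDensityFamily_densA _)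
    (hB.mixture_nonneg hcB P.isDensityFamily_densB _)

/-- For product weights the sum of `viewDensity` over `z = (x, y)` factors, so the view again has a
product density. The additivity of the leakage rests on this. -/
theorem map_view_marginal (hcA : 0 < cA) (hcB : 0 < cB) (hA : IsWeight cA wA)
    (hB : IsWeight cB wB) :
    ((weightMeasure fun z : X × Y => wA z.1 * wB z.2).prod P.law).map
      (fun ω => P.view ω.1 ω.2) =
      P.base.withDensity fun v => ENNReal.ofReal (P.mixedDensity wA wB v) := by
  refine Measure.ext_of_lintegral _ fun F hF => ?_
  have hv := P.measurable_uncurry_view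
  have hm := P.measurable_mixedDensity wA wB
  rw [lintegral_map hF hv, lintegral_prod _ (by fun_prop),
    lintegral_withDensity_eq_lintegral_mul _ (by fun_prop) hF, lintegral_fintype]
  simp_rw [weightMeasure_singleton, P.lintegral_view_eq_base hF,
    mul_comm _ (ENNReal.ofReal (_ * _))]
  have hd : ∀ z, Measurable fun v => ENNReal.ofReal (P.viewDensity z v) * F v := fun z => by
    have := P.measurable_viewDensity z
    fun_prop
  simp_rw [← lintegral_const_mul _ (hd _)]
  rw [← lintegral_finsetSum _ fun z _ => (hd z).const_mul _]
  refine lintegral_congr fun v => ?_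
  have h0 : ∀ z : X × Y, 0 ≤ wA z.1 * wB z.2 := fun z =>
    mul_nonneg (hA.nonneg hcA _) (hB.nonneg hcB _)
  have h1 : ∀ z, 0 ≤ P.viewDensity z v := fun z =>
    mul_nonneg (msgDensity_nonneg _ _ _ _) (msgDensity_nonneg _ _ _ _)
  simp_rw [← mul_assoc, ← ENNReal.ofReal_mul (h0 _)]
  rw [← Finset.sum_mul, ← ENNReal.ofReal_sum_of_nonneg fun z _ => mul_nonneg (h0 z) (h1 z)]
  simp only [Pi.mul_apply]
  congr 2
  rw [mixedDensity, mixture, mixture, Finset.sum_mul_sum, Fintype.sum_prod_type]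
  refine Finset.sum_congr rfl fun x _ => Finset.sum_congr rfl fun y _ => ?_
  rw [viewDensity]
  ring

theorem viewDensity_le (hcA : 0 < cA) (hcB : 0 < cB) (hA : IsWeight cA wA)
    (hB : IsWeight cB wB) (z : X × Y) (v : P.View) :
    P.viewDensity z v ≤ (cA⁻¹ * cB⁻¹) * P.mixedDensity wA wB v := by
  have h1 := hA.le_mul_mixture hcA P.isDensityFamily_densA z.1 (v.1, v.2.2.2.1)
  have h2 := hB.le_mul_mixture hcB P.isDensityFamily_densB z.2 (v.2.1, v.2.2.2.2)
  calc _ ≤ (cA⁻¹ * mixture wA P.densA (v.1, v.2.2.2.1)) *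
        (cB⁻¹ * mixture wB P.densB (v.2.1, v.2.2.2.2)) :=
        mul_le_mul h1 h2 (msgDensity_nonneg _ _ _ _) ((msgDensity_nonneg _ _ _ _).trans h1)
    _ = _ := by rw [mixedDensity]; ring

/-- The relative entropy between the joint law of inputs and view and the product of the marginal
laws, for independent inputs. -/
theorem toReal_klDiv_view (hcA : 0 < cA) (hcB : 0 < cB) (hA : IsWeight cA wA)
    (hB : IsWeight cB wB) [IsProbabilityMeasure (weightMeasure fun z : X × Y => wA z.1 * wB z.2)] :
    (InformationTheory.klDiv
      (((weightMeasure fun z : X × Y => wA z.1 * wB z.2).prod P.law).map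
        fun ω => (ω.1, P.view ω.1 ω.2))
      ((((weightMeasure fun z : X × Y => wA z.1 * wB z.2).prod P.law).map fun ω => ω.1).prod
        (((weightMeasure fun z : X × Y => wA z.1 * wB z.2).prod P.law).map
          fun ω => P.view ω.1 ω.2))).toReal =
      channelInfo (Measure.count.prod P.lawAC) P.densA wA +
        channelInfo (Measure.count.prod P.lawBC) P.densB wB := by
  set μ := weightMeasure fun z : X × Y => wA z.1 * wB z.2 with hμ
  set J := (μ.prod P.law).map fun ω => (ω.1, P.view ω.1 ω.2) with hJ
  set V := (μ.prod P.law).map fun ω => P.view ω.1 ω.2 with hV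
  have hv := P.measurable_uncurry_view
  have hd := P.measurable_uncurry_viewDensity
  have hm := P.measurable_mixedDensity wA wB
  have hfst : ((μ.prod P.law).map fun ω => ω.1) = μ := by
    have := Measure.map_fst_prod (μ := μ) (ν := P.law)
    rwa [measure_univ, one_smul] at this
  rw [hfst]
  have : IsProbabilityMeasure J :=
    Measure.isProbabilityMeasure_map (measurable_fst.prodMk hv).aemeasurable
  have : IsProbabilityMeasure V := Measure.isProbabilityMeasure_map hv.aemeasurable
  have hprod : μ.prod V = (μ.prod P.base).withDensity
      fun ω => ENNReal.ofReal (P.mixedDensity wA wB ω.2) := by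
    rw [hV, P.map_view_marginal hcA hcB hA hB, prod_withDensity_right (by fun_prop)]
  set h : (X × Y) × P.View → ℝ := fun ω => P.viewDensity ω.1 ω.2 / P.mixedDensity wA wB ω.2
    with hh
  have hmeas : Measurable h := by fun_prop
  have hd0 : ∀ z v, 0 ≤ P.viewDensity z v := fun z v =>
    mul_nonneg (msgDensity_nonneg _ _ _ _) (msgDensity_nonneg _ _ _ _)
  have hm0 := P.mixedDensity_nonneg hcA hcB hA hB
  have hJd : J = (μ.prod V).withDensity fun ω => ENNReal.ofReal (h ω) := by
    rw [hprod, ← withDensity_mul _ (by fun_prop) (by fun_prop), hJ, P.map_view_joint μ]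
    congr 1
    funext ω
    simp only [Pi.mul_apply]
    rw [← ENNReal.ofReal_mul (hm0 _), hh]
    congr 1
    -- Where the mixed density vanishes, so does the view density, by domination; the value of the
    -- quotient there is irrelevant.
    by_cases h0 : P.mixedDensity wA wB ω.2 = 0
    · have := P.viewDensity_le hcA hcB hA hB ω.1 ω.2
      rw [h0, mul_zero] at this
      rw [h0, zero_mul]
      exact le_antisymm this (hd0 _ _)
    · rw [mul_div_cancel₀ _ h0]
  have hac : J ≪ μ.prod V := by
    rw [hJd]
    exact withDensity_absolutelyContinuous _ _
  rw [InformationTheory.toReal_klDiv_of_measure_eq hac (by simp)]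
  have hllr : llr J (μ.prod V) =ᵐ[J] fun ω => Real.log (h ω) := by
    have h1 : J.rnDeriv (μ.prod V) =ᵐ[μ.prod V] fun ω => ENNReal.ofReal (h ω) := by
      conv_lhs => rw [hJd]
      exact Measure.rnDeriv_withDensity _ (by fun_prop)
    filter_upwards [hac.ae_le h1] with ω hω
    rw [llr, hω, ENNReal.toReal_ofReal (div_nonneg (hd0 _ _) (hm0 _))]
  rw [integral_congr_ae hllr, hJ, P.map_view_joint μ, integral_withDensity_eq_integral_toReal_smul
    (by fun_prop) (Filter.Eventually.of_forall fun _ => ENNReal.ofReal_lt_top)]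
  have hfamA := P.isDensityFamily_densA
  have hfamB := P.isDensityFamily_densB
  have hIA := fun x => hA.integrable_mul_log hcA hfamA x
  have hIB := fun y => hB.integrable_mul_log hcB hfamB y
  set ψA : X → P.MA × P.RAC → ℝ := fun x s =>
    P.densA x s * Real.log (P.densA x s / mixture wA P.densA s) with hψA
  set ψB : Y → P.MB × P.RBC → ℝ := fun y s =>
    P.densB y s * Real.log (P.densB y s / mixture wB P.densB s) with hψB
  have hψAm : ∀ x, Measurable (ψA x) := fun x =>
    (hfamA.measurable x).mul ((hfamA.measurable x).div (hfamA.measurable_mixture wA)).log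
  have hψBm : ∀ y, Measurable (ψB y) := fun y =>
    (hfamB.measurable y).mul ((hfamB.measurable y).div (hfamB.measurable_mixture wB)).log
  have hψAb : ∀ x s, |ψA x s| ≤ |Real.log cA⁻¹| + 1 := fun x s =>
    abs_mul_log_div_le (hfamA.nonneg x s) (hfamA.le_one x s) (hA.mixture_nonneg hcA hfamA s)
      (hA.mixture_le_one hcA hfamA s) (hA.le_mul_mixture hcA hfamA x s)
  have hψBb : ∀ y s, |ψB y s| ≤ |Real.log cB⁻¹| + 1 := fun y s =>
    abs_mul_log_div_le (hfamB.nonneg y s) (hfamB.le_one y s) (hB.mixture_nonneg hcB hfamB s)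
      (hB.mixture_le_one hcB hfamB s) (hB.le_mul_mixture hcB hfamB y s)
  set GA : X × Y → P.View → ℝ := fun z v =>
    ψA z.1 (v.1, v.2.2.2.1) * P.densB z.2 (v.2.1, v.2.2.2.2) with hGA
  set GB : X × Y → P.View → ℝ := fun z v =>
    P.densA z.1 (v.1, v.2.2.2.1) * ψB z.2 (v.2.1, v.2.2.2.2) with hGB
  have hGAm : ∀ z, Measurable (GA z) := fun z =>
    ((hψAm z.1).comp (by fun_prop)).mul ((hfamB.measurable z.2).comp (by fun_prop))
  have hGBm : ∀ z, Measurable (GB z) := fun z =>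
    ((hfamA.measurable z.1).comp (by fun_prop)).mul ((hψBm z.2).comp (by fun_prop))
  have hGAb : ∀ z v, ‖GA z v‖ ≤ |Real.log cA⁻¹| + 1 := fun z v => by
    rw [hGA, Real.norm_eq_abs, abs_mul, abs_of_nonneg (hfamB.nonneg _ _)]
    exact (mul_le_of_le_one_right (abs_nonneg _) (hfamB.le_one _ _)).trans (hψAb _ _)
  have hGBb : ∀ z v, ‖GB z v‖ ≤ |Real.log cB⁻¹| + 1 := fun z v => by
    rw [hGB, Real.norm_eq_abs, abs_mul, abs_of_nonneg (hfamA.nonneg _ _), mul_comm]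
    exact (mul_le_of_le_one_right (abs_nonneg _) (hfamA.le_one _ _)).trans (hψBb _ _)
  have hGAi : ∀ z, Integrable (GA z) P.base := fun z => Integrable.of_bound
    (hGAm z).aestronglyMeasurable _ (Filter.Eventually.of_forall (hGAb z))
  have hGBi : ∀ z, Integrable (GB z) P.base := fun z => Integrable.of_bound
    (hGBm z).aestronglyMeasurable _ (Filter.Eventually.of_forall (hGBb z))
  -- Both densities are products, so the logarithm of their ratio is a sum of an Alice term and a
  -- Bob term.
  have hpt : ∀ ω : (X × Y) × P.View, (ENNReal.ofReal (P.viewDensity ω.1 ω.2)).toReal •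
      Real.log (h ω) = GA ω.1 ω.2 + GB ω.1 ω.2 := by
    rintro ⟨z, v⟩
    simp only [hh, hGA, hGB, hψA, hψB, smul_eq_mul]
    rw [ENNReal.toReal_ofReal (hd0 z v), viewDensity, mixedDensity]
    rcases (hfamA.nonneg z.1 (v.1, v.2.2.2.1)).eq_or_lt with h0 | h1
    · simp [← h0]
    rcases (hfamB.nonneg z.2 (v.2.1, v.2.2.2.2)).eq_or_lt with h0 | h2
    · simp [← h0]
    have h3 : 0 < mixture wA P.densA (v.1, v.2.2.2.1) := pos_of_mul_pos_right
      (h1.trans_le (hA.le_mul_mixture hcA hfamA z.1 _)) (inv_pos.mpr hcA).le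
    have h4 : 0 < mixture wB P.densB (v.2.1, v.2.2.2.2) := pos_of_mul_pos_right
      (h2.trans_le (hB.le_mul_mixture hcB hfamB z.2 _)) (inv_pos.mpr hcB).le
    rw [mul_div_mul_comm, Real.log_mul (div_pos h1 h3).ne' (div_pos h2 h4).ne']
    ring
  have hGint : Integrable (fun ω : (X × Y) × P.View => GA ω.1 ω.2 + GB ω.1 ω.2)
      (μ.prod P.base) := by
    refine Integrable.of_bound (Measurable.aestronglyMeasurable
      (measurable_from_prod_countable_right fun z => (hGAm z).add (hGBm z)))
      ((|Real.log cA⁻¹| + 1) + (|Real.log cB⁻¹| + 1)) (Filter.Eventually.of_forall fun ω => ?_)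
    exact (norm_add_le _ _).trans (add_le_add (hGAb _ _) (hGBb _ _))
  have hz : ∀ z : X × Y, ∫ v, (GA z v + GB z v) ∂P.base =
      relEnt (Measure.count.prod P.lawAC) (P.densA z.1) (mixture wA P.densA) +
        relEnt (Measure.count.prod P.lawBC) (P.densB z.2) (mixture wB P.densB) := by
    intro z
    rw [integral_add (hGAi z) (hGBi z),
      P.integral_base_mul (hIA z.1) (hfamB.integrable z.2) (hGAi z),
      P.integral_base_mul (hfamA.integrable z.1) (hIB z.2) (hGBi z), hfamA.integral,
      hfamB.integral, mul_one, one_mul]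
    rfl
  rw [integral_congr_ae (Filter.Eventually.of_forall hpt), integral_prod _ hGint,
    integral_fintype Integrable.of_finite]
  simp only [hz, measureReal_def, hμ, weightMeasure_singleton, smul_eq_mul]
  simp_rw [ENNReal.toReal_ofReal (mul_nonneg (hA.nonneg hcA _) (hB.nonneg hcB _)), mul_add]
  rw [Finset.sum_add_distrib, Fintype.sum_prod_type, Fintype.sum_prod_type_right]
  congr 1
  · refine Finset.sum_congr rfl fun x _ => ?_
    simp only []
    rw [← Finset.sum_mul, ← Finset.mul_sum, hB.sum, mul_one]
  · refine Finset.sum_congr rfl fun y _ => ?_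
    simp only []
    rw [← Finset.sum_mul, ← Finset.sum_mul, hA.sum, one_mul]

/-- The information revealed by the two players' messages on independent inputs is at most
the leakage. -/
theorem channelInfo_add_le_leakage (hcA : 0 < cA) (hcB : 0 < cB) (hA : IsWeight cA wA)
    (hB : IsWeight cB wB) (hfin : P.leakage ≠ ∞) :
    channelInfo (Measure.count.prod P.lawAC) P.densA wA +
      channelInfo (Measure.count.prod P.lawBC) P.densB wB ≤
        P.leakage.toReal * Real.log 2 := by
  have hprob : IsProbabilityMeasure (weightMeasure fun z : X × Y => wA z.1 * wB z.2) := by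
    refine isProbabilityMeasure_weightMeasure
      (fun z => mul_nonneg (hA.nonneg hcA _) (hB.nonneg hcB _)) ?_
    rw [Fintype.sum_prod_type]
    simp only []
    rw [← Fintype.sum_mul_sum, hA.sum, hB.sum, one_mul]
  have hle : P.leakageOn (weightMeasure fun z : X × Y => wA z.1 * wB z.2) ≤ P.leakage :=
    le_iSup₂ (f := fun (μ : Measure (X × Y)) (_ : IsProbabilityMeasure μ) => P.leakageOn μ)
      _ hprob
  have h := ENNReal.toReal_mono hfin hle
  rw [leakageOn, mutualInfo, ENNReal.toReal_div, P.toReal_klDiv_view hcA hcB hA hB,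
    ENNReal.toReal_ofReal (Real.log_pos one_lt_two).le,
    div_le_iff₀ (Real.log_pos one_lt_two)] at h
  exact h

end SharedProtocol

/-! ### Removal of the shared seeds -/

/-- Shared seeds can be replaced by a small number of fixed seeds, the choice among which is made
privately by the players and sent along. -/
theorem exists_privateProtocol_of_seeds {X Y SA SB : Type*} [Fintype X] [Fintype Y]
    [MeasurableSpace SA] [MeasurableSpace SB] (νA : Measure SA) (νB : Measure SB)
    [IsProbabilityMeasure νA] [IsProbabilityMeasure νB] (OA OB : Type) [Fintype OA] [Fintype OB]
    (a : X → SA → OA → ℝ) (ham : ∀ x o, Measurable fun s => a x s o) (ha0 : ∀ x s o, 0 ≤ a x s o)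
    (ha1 : ∀ x s, ∑ o, a x s o = 1)
    (b : Y → SB → OB → ℝ) (hbm : ∀ y o, Measurable fun s => b y s o) (hb0 : ∀ y s o, 0 ≤ b y s o)
    (hb1 : ∀ y s, ∑ o, b y s o = 1)
    (γ : OA → OB → Bool → SA × SB → ℝ) (hγm : ∀ o o' v, Measurable (γ o o' v))
    (hγ0 : ∀ o o' v s, 0 ≤ γ o o' v s) (hγ1 : ∀ o o' s, ∑ v, γ o o' v s = 1)
    (f : X → Y → Bool) {η δ : ℝ} (hδ : 0 < δ) {T : ℕ} (hT : 0 < T)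
    (hcard : Fintype.card (X × Y) * Real.exp (-(2 * T * δ ^ 2)) < 1)
    (herr : ∀ x y, ∫ s, ∑ o, ∑ o', a x s.1 o * b y s.2 o' * γ o o' (!f x y) s ∂(νA.prod νB) ≤ η) :
    ∃ P : PrivateProtocol X Y, P.Computes f (η + δ + δ) ∧
      P.cost = Nat.clog 2 (T * Fintype.card OA) + Nat.clog 2 (T * Fintype.card OB) := by
  have hT' : (0 : ℝ) < T := by exact_mod_cast hT
  have hγle : ∀ o o' v s, γ o o' v s ≤ 1 := fun o o' v s => by
    rw [← hγ1 o o' s]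
    exact Finset.single_le_sum (f := fun v => γ o o' v s) (fun v _ => hγ0 o o' v s)
      (Finset.mem_univ v)
  set E : X × Y → SA × SB → ℝ := fun z s =>
    ∑ o, ∑ o', a z.1 s.1 o * b z.2 s.2 o' * γ o o' (!f z.1 z.2) s with hE
  have hEm : ∀ z, Measurable (E z) := fun z =>
    Finset.measurable_sum _ fun o _ => Finset.measurable_sum _ fun o' _ =>
      (((ham z.1 o).comp measurable_fst).mul ((hbm z.2 o').comp measurable_snd)).mul (hγm _ _ _)
  have hE0 : ∀ z s, 0 ≤ E z s := fun z s => Finset.sum_nonneg fun o _ =>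
    Finset.sum_nonneg fun o' _ => mul_nonneg (mul_nonneg (ha0 _ _ _) (hb0 _ _ _)) (hγ0 _ _ _ _)
  have hE1 : ∀ z s, E z s ≤ 1 := fun z s => by
    calc E z s ≤ ∑ o, ∑ o', a z.1 s.1 o * b z.2 s.2 o' :=
          Finset.sum_le_sum fun o _ => Finset.sum_le_sum fun o' _ =>
            mul_le_of_le_one_right (mul_nonneg (ha0 _ _ _) (hb0 _ _ _)) (hγle _ _ _ _)
      _ = 1 := by rw [← Fintype.sum_mul_sum, ha1, hb1, one_mul]
  have hEi : ∀ z, Integrable (E z) (νA.prod νB) := fun z =>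
    Integrable.of_mem_Icc 0 1 (hEm z).aemeasurable
      (Filter.Eventually.of_forall fun s => ⟨hE0 z s, hE1 z s⟩)
  have hEis : ∀ z u, Integrable (fun t => E z (u, t)) νB := fun z u =>
    Integrable.of_mem_Icc 0 1 ((hEm z).comp (by fun_prop)).aemeasurable
      (Filter.Eventually.of_forall fun s => ⟨hE0 z _, hE1 z _⟩)
  -- Alice's seeds are fixed first, against the error averaged over Bob's seed.
  obtain ⟨u, hu⟩ := exists_sample_average_le νA (fun z s => ∫ t, E z (s, t) ∂νB)
    (fun z => (hEm z).stronglyMeasurable.integral_prod_right.measurable)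
    (fun z s => ⟨integral_nonneg fun t => hE0 z _, by
      refine (integral_mono (hEis z s) (integrable_const 1) fun t => hE1 z _).trans ?_
      simp⟩) hT hδ hcard
  -- Bob's seeds are then fixed against the average over Alice's `T` seeds. Two rounds, at a cost of
  -- `δ` each, keep the players' choices of seed independent.
  obtain ⟨w, hw⟩ := exists_sample_average_le νB (fun z t => (∑ i, E z (u i, t)) / T)
    (fun z => (Finset.measurable_sum _ fun i _ => (hEm z).comp (by fun_prop)).div_const _)
    (fun z t => ⟨div_nonneg (Finset.sum_nonneg fun i _ => hE0 z _) hT'.le, by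
      rw [div_le_one hT']
      refine (Finset.sum_le_sum fun i _ => hE1 z _).trans ?_
      simp⟩) hT hδ hcard
  have hle : ∀ z, (∑ j, (∑ i, E z (u i, w j)) / T) / T ≤ η + δ + δ := by
    intro z
    refine (hw z).trans ?_
    rw [integral_div, integral_finsetSum _ fun i _ => hEis z (u i)]
    have h1 := hu z
    rw [← integral_prod _ (hEi z)] at h1
    linarith [herr z.1 z.2]
  have h := exists_privateProtocol (Fin T × OA) (Fin T × OB)
    (fun x m => a x (u m.1) m.2 / T) (fun x m => div_nonneg (ha0 _ _ _) hT'.le)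
    (fun x => by simp [Fintype.sum_prod_type, ← Finset.sum_div, ha1, hT'.ne'])
    (fun y m => b y (w m.1) m.2 / T) (fun x m => div_nonneg (hb0 _ _ _) hT'.le)
    (fun x => by simp [Fintype.sum_prod_type, ← Finset.sum_div, hb1, hT'.ne'])
    (fun m m' v => γ m.2 m'.2 v (u m.1, w m'.1)) (fun m m' v => hγ0 _ _ _ _)
    (fun m m' => hγ1 _ _ _) f (η + δ + δ) (fun x y => by
      refine le_trans (le_of_eq ?_) (hle (x, y))
      simp only [hE, Fintype.sum_prod_type, Finset.sum_div]
      calc _ = ∑ i, ∑ j, ∑ o, ∑ o', a x (u i) o / T * (b y (w j) o' / T) *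
            γ o o' (!f x y) (u i, w j) :=
            Finset.sum_congr rfl fun i _ => Finset.sum_comm
        _ = _ := by
            rw [Finset.sum_comm]
            refine Finset.sum_congr rfl fun j _ => Finset.sum_congr rfl fun i _ =>
              Finset.sum_congr rfl fun o _ => Finset.sum_congr rfl fun o' _ => ?_
            field_simp)
  simpa using h

/-! ### The compressed protocol and its error -/

namespace SharedProtocol

variable {X Y : Type*} (P : SharedProtocol X Y)

/-- The referee's output distribution, given both messages and the shared strings. -/
noncomputable def outProb (v : Bool) (s : (P.MA × P.RAC) × (P.MB × P.RBC)) : ℝ :=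
  P.lawC.real {c | P.out s.1.1 s.2.1 (c, s.1.2, s.2.2) = v}

theorem measurable_outProb (v : Bool) : Measurable (P.outProb v) := by
  have h : ∀ m m', Measurable fun r : P.RAC × P.RBC => P.outProb v ((m, r.1), (m', r.2)) := by
    intro m m'
    have hs : MeasurableSet {c : P.RC × P.RAC × P.RBC | P.out m m' c = v} :=
      P.measurable_out m m' (measurableSet_singleton v)
    exact (measurable_measure_prodMk_right hs).ennreal_toReal
  have h2 : Measurable fun s : (P.MA × P.MB) × (P.RAC × P.RBC) =>
      P.outProb v ((s.1.1, s.2.1), (s.1.2, s.2.2)) :=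
    measurable_from_prod_countable_right fun m => h m.1 m.2
  exact h2.comp (g := fun s : (P.MA × P.MB) × (P.RAC × P.RBC) =>
      P.outProb v ((s.1.1, s.2.1), (s.1.2, s.2.2)))
    (f := fun s : (P.MA × P.RAC) × (P.MB × P.RBC) => ((s.1.1, s.2.1), (s.1.2, s.2.2)))
    (by fun_prop)

theorem outProb_nonneg (v : Bool) (s) : 0 ≤ P.outProb v s := measureReal_nonneg

theorem sum_outProb (s) : ∑ v, P.outProb v s = 1 := by
  have hm : Measurable fun c => P.out s.1.1 s.2.1 (c, s.1.2, s.2.2) :=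
    (P.measurable_out s.1.1 s.2.1).comp (by fun_prop)
  have hs : MeasurableSet {c | P.out s.1.1 s.2.1 (c, s.1.2, s.2.2) = true} :=
    hm (measurableSet_singleton true)
  have hc : {c | P.out s.1.1 s.2.1 (c, s.1.2, s.2.2) = false} =
      {c | P.out s.1.1 s.2.1 (c, s.1.2, s.2.2) = true}ᶜ := by
    ext c; simp
  rw [Fintype.sum_bool, outProb, outProb, hc, probReal_compl_eq_one_sub hs]
  ring

/-- The error of `P` with all private strings integrated out, a form in which the messages can be
replaced by samples one player at a time. -/
theorem lintegral_outProb_le {f : X → Y → Bool} {ε : ℝ} (hP : P.Computes f ε) (x : X) (y : Y) :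
    ∫⁻ r, ∫⁻ r', ∑ m, ENNReal.ofReal (P.densA x (m, r)) * ∑ m', ENNReal.ofReal (P.densB y (m', r'))
      * ENNReal.ofReal (P.outProb (!f x y) ((m, r), (m', r'))) ∂P.lawBC ∂P.lawAC ≤
        ENNReal.ofReal ε := by
  have hS : MeasurableSet {v : P.View | P.out v.1 v.2.1 v.2.2 = !f x y} := by
    have h : Measurable fun v : P.View => P.out v.1 v.2.1 v.2.2 :=
      measurable_from_prod_countable_right fun m =>
        measurable_from_prod_countable_right fun m' => P.measurable_out m m'
    exact h (measurableSet_singleton _)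
  have h1 : ∫⁻ r, {v : P.View | P.out v.1 v.2.1 v.2.2 = !f x y}.indicator 1
      (P.view (x, y) r) ∂P.law ≤ ENNReal.ofReal ε := by
    have h2 := lintegral_indicator_one (μ := P.law) ((P.measurable_view (x, y)) hS)
    refine (le_of_eq h2).trans ?_
    rw [← ofReal_measureReal]
    refine ENNReal.ofReal_le_ofReal (le_trans (le_of_eq ?_) (hP x y))
    congr 1
    ext r
    exact Bool.eq_not
  have hA := fun x => P.isDensityFamily_densA.measurable x
  have hB := fun y => P.isDensityFamily_densB.measurable y
  have ho := P.measurable_outProb (!f x y)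
  rw [P.lintegral_view (measurable_one.indicator hS)] at h1
  refine le_trans (le_of_eq ?_) h1
  have hI : Measurable ({v : P.View | P.out v.1 v.2.1 v.2.2 = !f x y}.indicator
      (1 : P.View → ℝ≥0∞)) := measurable_one.indicator hS
  have hΦ : Measurable fun c : P.RC × P.RAC × P.RBC => ∑ m, ENNReal.ofReal (P.densA x (m, c.2.1)) *
      ∑ m', ENNReal.ofReal (P.densB y (m', c.2.2)) *
        {v : P.View | P.out v.1 v.2.1 v.2.2 = !f x y}.indicator 1 (m, m', c) := by fun_prop
  rw [lintegral_prod_symm' _ hΦ, lintegral_prod _ hΦ.lintegral_prod_left'.aemeasurable]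
  refine lintegral_congr fun r => lintegral_congr fun r' => ?_
  dsimp only
  rw [lintegral_finsetSum _ fun m _ => by fun_prop]
  refine Finset.sum_congr rfl fun m _ => ?_
  rw [lintegral_const_mul _ (by fun_prop), lintegral_finsetSum _ fun m _ => by fun_prop]
  congr 1
  refine Finset.sum_congr rfl fun m' _ => ?_
  rw [lintegral_const_mul _ (by fun_prop)]
  congr 1
  have hs : MeasurableSet {c : P.RC | P.out m m' (c, r, r') = !f x y} :=
    ((P.measurable_out m m').comp (by fun_prop : Measurable fun c : P.RC => (c, r, r')))
      (measurableSet_singleton _)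
  rw [outProb, ofReal_measureReal, ← lintegral_indicator_one hs]
  rfl

end SharedProtocol

namespace SharedProtocol

variable {X Y : Type*} (P : SharedProtocol X Y)

/-- The referee's behaviour in the compressed protocol: if both players have selected a sample,
the referee proceeds as in `P`, otherwise it outputs a fair coin. -/
noncomputable def compressedOut {NA NB : ℕ} (v : Bool)
    (s : (P.RAC × (Fin NA → P.MA)) × (P.RBC × (Fin NB → P.MB))) :
    Option (Fin NA) → Option (Fin NB) → ℝ
  | some i, some j => P.outProb v ((s.1.2 i, s.1.1), (s.2.2 j, s.2.1))
  | _, _ => 1 / 2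

theorem measurable_compressedOut {NA NB : ℕ} (v : Bool) (o : Option (Fin NA))
    (o' : Option (Fin NB)) : Measurable fun s => P.compressedOut v s o o' := by
  have h := P.measurable_outProb v
  rcases o with _ | i <;> rcases o' with _ | j <;> simp only [compressedOut] <;> fun_prop

theorem compressedOut_nonneg {NA NB : ℕ} (v : Bool) (s) (o : Option (Fin NA))
    (o' : Option (Fin NB)) : 0 ≤ P.compressedOut v s o o' := by
  rcases o with _ | i <;> rcases o' with _ | j <;> simp only [compressedOut] <;>
    first | positivity | exact P.outProb_nonneg _ _

theorem sum_compressedOut {NA NB : ℕ} (s) (o : Option (Fin NA)) (o' : Option (Fin NB)) :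
    ∑ v, P.compressedOut v s o o' = 1 := by
  rcases o with _ | i <;> rcases o' with _ | j <;> simp only [compressedOut]
  case some.some => exact P.sum_outProb _
  all_goals norm_num

variable {qA : P.MA × P.RAC → ℝ} {qB : P.MB × P.RBC → ℝ}

/-- The error of the compressed protocol: every failure to select a sample costs `1 / 2`. -/
theorem integral_compressed_error_le {f : X → Y → Bool} {ε δ : ℝ} (hε : 0 ≤ ε) (hδ : 0 ≤ δ)
    (hP : P.Computes f ε) (hqA : Measurable qA) (hqA0 : ∀ s, 0 ≤ qA s)
    (hqA1 : ∀ r, ∑ m, qA (m, r) = 1) (hqB : Measurable qB) (hqB0 : ∀ s, 0 ≤ qB s)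
    (hqB1 : ∀ r, ∑ m, qB (m, r) = 1) {NA NB : ℕ} (x : X) (y : Y)
    (hfailA : ∫⁻ a, ENNReal.ofReal (pick (fun m => P.densA x (m, a.1)) (fun m => qA (m, a.1))
      a.2 none) ∂(seedMeasure P.lawAC qA NA) ≤ ENNReal.ofReal δ)
    (hfailB : ∫⁻ b, ENNReal.ofReal (pick (fun m => P.densB y (m, b.1)) (fun m => qB (m, b.1))
      b.2 none) ∂(seedMeasure P.lawBC qB NB) ≤ ENNReal.ofReal δ) :
    ∫ s, ∑ o, ∑ o', pick (fun m => P.densA x (m, s.1.1)) (fun m => qA (m, s.1.1)) s.1.2 o *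
      pick (fun m => P.densB y (m, s.2.1)) (fun m => qB (m, s.2.1)) s.2.2 o' *
        P.compressedOut (!f x y) s o o'
      ∂((seedMeasure P.lawAC qA NA).prod (seedMeasure P.lawBC qB NB)) ≤ ε + δ := by
  have hpA := isProbabilityMeasure_seedMeasure (ρ := P.lawAC) hqA hqA0 hqA1 NA
  have hpB := isProbabilityMeasure_seedMeasure (ρ := P.lawBC) hqB hqB0 hqB1 NB
  set νA := seedMeasure P.lawAC qA NA
  set νB := seedMeasure P.lawBC qB NB
  have hdA := P.isDensityFamily_densA.measurable x
  have hdB := P.isDensityFamily_densB.measurable y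
  have hdA0 := P.isDensityFamily_densA.nonneg x
  have hdB0 := P.isDensityFamily_densB.nonneg y
  have hdA1 := sum_msgDensity P.lawA P.measurable_msgA x
  have hdB1 := sum_msgDensity P.lawB P.measurable_msgB y
  set a : P.RAC × (Fin NA → P.MA) → Option (Fin NA) → ℝ := fun s o =>
    pick (fun m => P.densA x (m, s.1)) (fun m => qA (m, s.1)) s.2 o
  set b : P.RBC × (Fin NB → P.MB) → Option (Fin NB) → ℝ := fun s o =>
    pick (fun m => P.densB y (m, s.1)) (fun m => qB (m, s.1)) s.2 o
  have ham : ∀ o, Measurable fun s => a s o := fun o => measurable_pick_seed hdA hqA o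
  have hbm : ∀ o, Measurable fun s => b s o := fun o => measurable_pick_seed hdB hqB o
  have ha0 : ∀ s o, 0 ≤ a s o := fun s o =>
    pick_nonneg (fun m => hdA0 _) (hdA1 s.1) (fun m => hqA0 _) _ _
  have hb0 : ∀ s o, 0 ≤ b s o := fun s o =>
    pick_nonneg (fun m => hdB0 _) (hdB1 s.1) (fun m => hqB0 _) _ _
  have ha1 : ∀ s, ∑ o, a s o = 1 := fun s => sum_pick _ _ _
  have hb1 : ∀ s, ∑ o, b s o = 1 := fun s => sum_pick _ _ _
  have ho := P.measurable_outProb (!f x y)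
  have ho0 := P.outProb_nonneg (!f x y)
  have hcm := fun o o' => P.measurable_compressedOut (NA := NA) (NB := NB) (!f x y) o o'
  change ∫ s, ∑ o, ∑ o', a s.1 o * b s.2 o' * P.compressedOut (!f x y) s o o' ∂(νA.prod νB) ≤ ε + δ
  rw [integral_eq_lintegral_of_nonneg_ae (Filter.Eventually.of_forall fun s =>
    Finset.sum_nonneg fun o _ => Finset.sum_nonneg fun o' _ =>
      mul_nonneg (mul_nonneg (ha0 _ _) (hb0 _ _)) (P.compressedOut_nonneg _ _ _ _))
    (Measurable.aestronglyMeasurable (by fun_prop))]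
  refine ENNReal.toReal_le_of_le_ofReal (by positivity) ?_
  have hpt : ∀ s, ENNReal.ofReal
      (∑ o, ∑ o', a s.1 o * b s.2 o' * P.compressedOut (!f x y) s o o') ≤
      (∑ i, ENNReal.ofReal (a s.1 (some i)) * ∑ j, ENNReal.ofReal (b s.2 (some j)) *
        ENNReal.ofReal (P.outProb (!f x y) ((s.1.2 i, s.1.1), (s.2.2 j, s.2.1)))) +
      (ENNReal.ofReal (a s.1 none) * ENNReal.ofReal (1 / 2) +
        ENNReal.ofReal (b s.2 none) * ENNReal.ofReal (1 / 2)) := by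
    intro s
    -- Union bound: the event that some player selects nothing has mass at most `a s.1 none + b s.2
    -- none`, and there the coin errs with probability `1 / 2`.
    have hreal : ∑ o, ∑ o', a s.1 o * b s.2 o' * P.compressedOut (!f x y) s o o' ≤
        (∑ i, a s.1 (some i) * ∑ j, b s.2 (some j) *
          P.outProb (!f x y) ((s.1.2 i, s.1.1), (s.2.2 j, s.2.1))) +
        (a s.1 none * (1 / 2) + b s.2 none * (1 / 2)) := by
      have hA := ha1 s.1
      have hB := hb1 s.2
      rw [Fintype.sum_option] at hA hB
      simp only [Fintype.sum_option, compressedOut, Finset.sum_add_distrib, Finset.mul_sum,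
        ← mul_assoc]
      rw [← Finset.sum_mul, ← Finset.sum_mul, ← Finset.sum_mul, ← Finset.mul_sum]
      have h1 := ha0 s.1 none
      have h2 := hb0 s.2 none
      rw [← eq_sub_iff_add_eq'] at hA hB
      rw [hA, hB]
      nlinarith [mul_nonneg h1 h2]
    have hin : ∀ i j, 0 ≤ b s.2 (some j) *
        P.outProb (!f x y) ((s.1.2 i, s.1.1), (s.2.2 j, s.2.1)) :=
      fun i j => mul_nonneg (hb0 _ _) (ho0 _)
    refine (ENNReal.ofReal_le_ofReal hreal).trans (ENNReal.ofReal_add_le.trans (add_le_add ?_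
      (ENNReal.ofReal_add_le.trans (add_le_add ?_ ?_))))
    · rw [ENNReal.ofReal_sum_of_nonneg fun i _ => mul_nonneg (ha0 _ _)
        (Finset.sum_nonneg fun j _ => hin i j)]
      refine Finset.sum_le_sum fun i _ => ?_
      rw [ENNReal.ofReal_mul (ha0 _ _), ENNReal.ofReal_sum_of_nonneg fun j _ => hin i j]
      simp_rw [ENNReal.ofReal_mul (hb0 _ _)]
      exact le_rfl
    · rw [ENNReal.ofReal_mul (ha0 _ _)]
    · rw [ENNReal.ofReal_mul (hb0 _ _)]
  -- With Bob's seed fixed, Alice's sample is replaced by her true message; after Tonelli the same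
  -- is done for Bob, which leaves the error of `P`.
  have hmain : ∫⁻ s, ∑ i, ENNReal.ofReal (a s.1 (some i)) * ∑ j, ENNReal.ofReal (b s.2 (some j)) *
      ENNReal.ofReal (P.outProb (!f x y) ((s.1.2 i, s.1.1), (s.2.2 j, s.2.1))) ∂(νA.prod νB) ≤
      ENNReal.ofReal ε := by
    rw [lintegral_prod_symm' _ (by fun_prop)]
    calc _ ≤ ∫⁻ t, ∫⁻ r, ∑ m, ENNReal.ofReal (P.densA x (m, r)) *
          ∑ j, ENNReal.ofReal (b t (some j)) *
            ENNReal.ofReal (P.outProb (!f x y) ((m, r), (t.2 j, t.1))) ∂P.lawAC ∂νB := by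
          refine lintegral_mono fun t => ?_
          exact lintegral_pick_some_le (ρ := P.lawAC) hdA hqA hdA0 hdA1 hqA0 hqA1
            (h := fun u => ∑ j, ENNReal.ofReal (b t (some j)) *
              ENNReal.ofReal (P.outProb (!f x y) (u, (t.2 j, t.1)))) (by fun_prop)
      _ = ∫⁻ r, ∫⁻ t, ∑ m, ENNReal.ofReal (P.densA x (m, r)) *
          ∑ j, ENNReal.ofReal (b t (some j)) *
            ENNReal.ofReal (P.outProb (!f x y) ((m, r), (t.2 j, t.1))) ∂νB ∂P.lawAC :=
          lintegral_lintegral_swap (Measurable.aemeasurable (by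
            simp only [Function.uncurry_def]; fun_prop))
      _ ≤ _ := by
          refine le_trans (lintegral_mono fun r => ?_) (P.lintegral_outProb_le hP x y)
          rw [lintegral_finsetSum _ fun m _ => by fun_prop,
            lintegral_finsetSum _ fun m _ => by fun_prop]
          refine Finset.sum_le_sum fun m _ => ?_
          rw [lintegral_const_mul _ (by fun_prop), lintegral_const_mul _ (by fun_prop)]
          gcongr
          exact lintegral_pick_some_le (ρ := P.lawBC) hdB hqB hdB0 hdB1 hqB0 hqB1
            (h := fun u => ENNReal.ofReal (P.outProb (!f x y) ((m, r), u))) (by fun_prop)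
  have hA' : ∫⁻ s, ENNReal.ofReal (a s.1 none) * ENNReal.ofReal (1 / 2) ∂(νA.prod νB) ≤
      ENNReal.ofReal (δ / 2) := by
    rw [lintegral_mul_const _ (by fun_prop), lintegral_prod _ (by fun_prop)]
    simp only [lintegral_const, measure_univ, mul_one]
    rw [div_eq_mul_one_div δ, ENNReal.ofReal_mul hδ]
    gcongr
  have hB' : ∫⁻ s, ENNReal.ofReal (b s.2 none) * ENNReal.ofReal (1 / 2) ∂(νA.prod νB) ≤
      ENNReal.ofReal (δ / 2) := by
    rw [lintegral_mul_const _ (by fun_prop), lintegral_prod_symm' _ (by fun_prop)]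
    simp only [lintegral_const, measure_univ, mul_one]
    rw [div_eq_mul_one_div δ, ENNReal.ofReal_mul hδ]
    gcongr
  refine (lintegral_mono hpt).trans ?_
  rw [lintegral_add_left (by fun_prop), lintegral_add_left (by fun_prop)]
  refine (add_le_add hmain (add_le_add hA' hB')).trans (le_of_eq ?_)
  rw [← ENNReal.ofReal_add (by positivity) (by positivity), add_halves,
    ← ENNReal.ofReal_add hε hδ]

/-- Compression: a shared-randomness protocol is turned into a private-coin protocol whose players
each send a choice of a seed and the index of a sample. -/
theorem exists_compressed [Fintype X] [Fintype Y] {f : X → Y → Bool} {ε δ δ' : ℝ} (hε : 0 ≤ ε)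
    (hδ : 0 ≤ δ) (hδ' : 0 < δ') (hP : P.Computes f ε) (hqA : Measurable qA)
    (hqA0 : ∀ s, 0 ≤ qA s) (hqA1 : ∀ r, ∑ m, qA (m, r) = 1) (hqB : Measurable qB)
    (hqB0 : ∀ s, 0 ≤ qB s) (hqB1 : ∀ r, ∑ m, qB (m, r) = 1) {KA KB : ℝ}
    (hKA : ∀ x s, P.densA x s ≤ KA * qA s) (hKB : ∀ y s, P.densB y s ≤ KB * qB s) {NA NB : ℕ}
    (hNA : 2 ≤ NA) (hNB : 2 ≤ NB)
    (hA : ∀ x, (relEnt (Measure.count.prod P.lawAC) (P.densA x) qA + 2) / Real.log NA ≤ δ)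
    (hB : ∀ y, (relEnt (Measure.count.prod P.lawBC) (P.densB y) qB + 2) / Real.log NB ≤ δ)
    {T : ℕ} (hT : 0 < T) (hcard : Fintype.card (X × Y) * Real.exp (-(2 * T * δ' ^ 2)) < 1) :
    ∃ Q : PrivateProtocol X Y, Q.Computes f (ε + δ + δ' + δ') ∧
      Q.cost = Nat.clog 2 (T * (NA + 1)) + Nat.clog 2 (T * (NB + 1)) := by
  have hpA := isProbabilityMeasure_seedMeasure (ρ := P.lawAC) hqA hqA0 hqA1 NA
  have hpB := isProbabilityMeasure_seedMeasure (ρ := P.lawBC) hqB hqB0 hqB1 NB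
  have hdA := P.isDensityFamily_densA.measurable
  have hdB := P.isDensityFamily_densB.measurable
  have hdA0 := P.isDensityFamily_densA.nonneg
  have hdB0 := P.isDensityFamily_densB.nonneg
  have hdA1 := sum_msgDensity P.lawA P.measurable_msgA
  have hdB1 := sum_msgDensity P.lawB P.measurable_msgB
  have h := exists_privateProtocol_of_seeds (seedMeasure P.lawAC qA NA)
    (seedMeasure P.lawBC qB NB) (Option (Fin NA)) (Option (Fin NB))
    (fun x s o => pick (fun m => P.densA x (m, s.1)) (fun m => qA (m, s.1)) s.2 o)
    (fun x o => measurable_pick_seed (hdA x) hqA o)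
    (fun x s o => pick_nonneg (fun m => hdA0 x _) (hdA1 x s.1) (fun m => hqA0 _) _ _)
    (fun x s => sum_pick _ _ _)
    (fun y s o => pick (fun m => P.densB y (m, s.1)) (fun m => qB (m, s.1)) s.2 o)
    (fun y o => measurable_pick_seed (hdB y) hqB o)
    (fun y s o => pick_nonneg (fun m => hdB0 y _) (hdB1 y s.1) (fun m => hqB0 _) _ _)
    (fun y s => sum_pick _ _ _)
    (fun o o' v s => P.compressedOut v s o o')
    (fun o o' v => P.measurable_compressedOut v o o')
    (fun o o' v s => P.compressedOut_nonneg v s o o')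
    (fun o o' s => P.sum_compressedOut s o o') f hδ' hT hcard
    (fun x y => P.integral_compressed_error_le hε hδ hP hqA hqA0 hqA1 hqB hqB0 hqB1 x y
      ((lintegral_pick_none_le (hdA x) hqA (hdA0 x) (hdA1 x) hqA0 hqA1 (hKA x) hNA).trans
        (ENNReal.ofReal_le_ofReal (hA x)))
      ((lintegral_pick_none_le (hdB y) hqB (hdB0 y) (hdB1 y) hqB0 hqB1 (hKB y) hNB).trans
        (ENNReal.ofReal_le_ofReal (hB y))))
  simpa using h

end SharedProtocol

/-! ### Choice of parameters and conclusion -/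

/-- The `2 ^ k` indices and the failure symbol together fit into `k + 1` bits. -/
theorem clog_mul_succ_le (T k : ℕ) :
    Nat.clog 2 (T * (2 ^ k + 1)) ≤ Nat.clog 2 T + k + 1 := by
  refine Nat.clog_le_of_le_pow ?_
  rw [add_assoc, pow_add]
  refine Nat.mul_le_mul (Nat.le_pow_clog one_lt_two T) ?_
  rw [pow_succ]
  have := Nat.one_le_two_pow (n := k)
  lia

theorem clog_le_logb_add_one {T : ℕ} (hT : 0 < T) :
    (Nat.clog 2 T : ℝ) ≤ Real.logb 2 T + 1 := by
  have h := Real.natCeil_logb_natCast 2 T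
  have h2 := Nat.ceil_lt_add_one (Real.logb_nonneg one_lt_two (show (1 : ℝ) ≤ T by
    exact_mod_cast hT))
  rw [Nat.cast_ofNat] at h
  rw [h] at h2
  exact h2.le

/-- The number of seeds that suffices for the simultaneous approximation of all error
probabilities. -/
theorem exists_seed_count (m n : ℕ) (hm : 0 < m) (hn : 0 < n) {δ : ℝ} (hδ : 0 < δ) :
    ∃ T : ℕ, 0 < T ∧ ((m * n : ℕ) : ℝ) * Real.exp (-(2 * T * (δ / 2) ^ 2)) < 1 ∧
      2 * (Nat.clog 2 T : ℝ) ≤ g₂ (Real.logb 2 m) (Real.logb 2 n) δ := by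
  have hm' : (0 : ℝ) < m := by exact_mod_cast hm
  have hn' : (0 : ℝ) < n := by exact_mod_cast hn
  have hl2 : 0 < Real.log 2 := Real.log_pos one_lt_two
  set A : ℝ := 2 * (Real.logb 2 m + Real.logb 2 n) / (δ ^ 2 * Real.logb 2 (Real.exp 1)) with hA
  have hA' : A = 2 * Real.log (m * n) / δ ^ 2 := by
    rw [hA, Real.log_mul hm'.ne' hn'.ne']
    simp only [Real.logb, Real.log_exp]
    field_simp
  have hlog : 0 ≤ Real.log (m * n) := Real.log_nonneg (by
    exact_mod_cast Nat.succ_le_of_lt (Nat.mul_pos hm hn))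
  have hA0 : 0 ≤ A := by rw [hA']; positivity
  -- Any `T > A = 2 * log (m * n) / δ ^ 2` makes the exponent `T * δ ^ 2 / 2` exceed `log (m * n)`.
  -- This `T` is also at most `A + 1`, the argument of the logarithm in `g₂`.
  refine ⟨⌊A⌋₊ + 1, Nat.succ_pos _, ?_, ?_⟩
  · have hlt : A < ((⌊A⌋₊ + 1 : ℕ) : ℝ) := by push_cast; exact Nat.lt_floor_add_one A
    have h1 : Real.log (m * n) < 2 * ((⌊A⌋₊ + 1 : ℕ) : ℝ) * (δ / 2) ^ 2 := by
      rw [hA', div_lt_iff₀ (by positivity), ← hA'] at hlt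
      nlinarith
    push_cast at h1 ⊢
    rw [Real.exp_neg, ← div_eq_mul_inv, div_lt_one (Real.exp_pos _)]
    exact (Real.log_lt_iff_lt_exp (mul_pos hm' hn')).mp h1
  · have h1 := clog_le_logb_add_one (Nat.succ_pos ⌊A⌋₊)
    have h2 : Real.logb 2 ((⌊A⌋₊ + 1 : ℕ) : ℝ) ≤ Real.logb 2 (A + 1) := by
      refine Real.logb_le_logb_of_le one_lt_two (by positivity) ?_
      push_cast
      linarith [Nat.floor_le hA0]
    rw [g₂, ← hA]
    linarith

/-- Choice of the number of samples in the compression of a player's message. -/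
theorem exists_sample_count {d δ : ℝ} (hd : 0 ≤ d) (hδ : 0 < δ) :
    ∃ k : ℕ, 1 ≤ k ∧ (k : ℝ) ≤ (d / Real.log 2 + 3) / δ + 1 ∧
      ∀ D ≤ d, (D + 2) / Real.log ((2 ^ k : ℕ) : ℝ) ≤ δ := by
  have hl2 : 0 < Real.log 2 := Real.log_pos one_lt_two
  have hpos : 0 < (d / Real.log 2 + 3) / δ := by positivity
  refine ⟨⌈(d / Real.log 2 + 3) / δ⌉₊, Nat.ceil_pos.mpr hpos, (Nat.ceil_lt_add_one hpos.le).le,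
    fun D hD => ?_⟩
  set k := ⌈(d / Real.log 2 + 3) / δ⌉₊
  have hk : (d / Real.log 2 + 3) / δ ≤ k := Nat.le_ceil _
  have hk0 : (0 : ℝ) < k := hpos.trans_le hk
  push_cast
  rw [Real.log_pow, div_le_iff₀ (by positivity)]
  rw [div_le_iff₀ hδ] at hk
  have h1 := mul_le_mul_of_nonneg_right hk hl2.le
  rw [add_mul, div_mul_cancel₀ _ hl2.ne'] at h1
  -- The summand `3` in `k` pays for the additive `2` nats, as `3 * log 2 > 2`.
  have h2 := Real.log_two_gt_d9
  nlinarith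

theorem IsWeight.sum_mixture {ι M R : Type*} [Fintype ι] [Fintype M] {c : ℝ} {w : ι → ℝ}
    (hw : IsWeight c w) {p : ι → M × R → ℝ} (hp : ∀ i r, ∑ m, p i (m, r) = 1) (r : R) :
    ∑ m, mixture w p (m, r) = 1 := by
  unfold mixture
  rw [Finset.sum_comm]
  simp_rw [← Finset.mul_sum, hp, mul_one]
  exact hw.sum

/-- The `4` collects, for each player, one bit of rounding in the sample count and one for the
failure symbol. The `8` is `2` from the bound `L + 2` on the divergences and `3` from each sample
count. -/
theorem SharedProtocol.le_leakage {X Y : Type*} [Fintype X] [Fintype Y] [Nonempty X] [Nonempty Y]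
    [MeasurableSpace X] [MeasurableSpace Y] [DiscreteMeasurableSpace X]
    [DiscreteMeasurableSpace Y] (P : SharedProtocol X Y) {f : X → Y → Bool} {ε δ₁ δ₂ : ℝ}
    (hε : 0 ≤ ε) (hδ₁ : 0 < δ₁) (hδ₂ : 0 < δ₂) (hP : P.Computes f ε) (hfin : P.leakage ≠ ∞) :
    δ₁ * ((CCpriv f (ε + δ₁ + δ₂) : ℝ)
      - g₂ (Real.logb 2 (Fintype.card X)) (Real.logb 2 (Fintype.card Y)) δ₂ - 4) ≤
        P.leakage.toReal + 8 := by
  set L := P.leakage.toReal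
  have hL : 0 ≤ L := ENNReal.toReal_nonneg
  have hl2 : 0 < Real.log 2 := Real.log_pos one_lt_two
  have hfamA := P.isDensityFamily_densA
  have hfamB := P.isDensityFamily_densB
  -- This gives `(L + 2) * (1 - t) = L + 1`: the leakage plus two slacks of half a bit, divided by
  -- `1 - t`, is exactly `L + 2` bits.
  set t : ℝ := 1 / (L + 2) with ht
  have ht0 : 0 < t := by positivity
  have ht1 : t < 1 := by rw [ht, div_lt_one (by positivity)]; linarith
  have hcA : 0 < t / Fintype.card X := div_pos ht0 (by exact_mod_cast Fintype.card_pos)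
  have hcB : 0 < t / Fintype.card Y := div_pos ht0 (by exact_mod_cast Fintype.card_pos)
  obtain ⟨wA, hwA, hDA⟩ := exists_weight_relEnt_le hfamA ht0 ht1 (η := Real.log 2 / 2)
    (by positivity)
  obtain ⟨wB, hwB, hDB⟩ := exists_weight_relEnt_le hfamB ht0 ht1 (η := Real.log 2 / 2)
    (by positivity)
  have hleak := P.channelInfo_add_le_leakage hcA hcB hwA hwB hfin
  set dA := (channelInfo (Measure.count.prod P.lawAC) P.densA wA + Real.log 2 / 2) / (1 - t)
  set dB := (channelInfo (Measure.count.prod P.lawBC) P.densB wB + Real.log 2 / 2) / (1 - t)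
  have hdA : ∀ x, relEnt (Measure.count.prod P.lawAC) (P.densA x) (mixture wA P.densA) ≤ dA :=
    fun x => by rw [le_div_iff₀' (by linarith)]; exact hDA x
  have hdB : ∀ y, relEnt (Measure.count.prod P.lawBC) (P.densB y) (mixture wB P.densB) ≤ dB :=
    fun y => by rw [le_div_iff₀' (by linarith)]; exact hDB y
  have hdA0 : 0 ≤ dA :=
    (hwA.relEnt_nonneg hcA hfamA (Classical.arbitrary X)).trans (hdA _)
  have hdB0 : 0 ≤ dB :=
    (hwB.relEnt_nonneg hcB hfamB (Classical.arbitrary Y)).trans (hdB _)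
  have hdsum : (dA + dB) / Real.log 2 ≤ L + 2 := by
    rw [div_le_iff₀ hl2, ← add_div, div_le_iff₀ (by linarith)]
    have : (L + 2) * (1 - t) = L + 1 := by rw [ht]; field_simp; ring
    calc _ ≤ (L + 1) * Real.log 2 := by linarith
      _ = _ := by rw [← this]; ring
  obtain ⟨kA, hkA1, hkA, hfA⟩ := exists_sample_count hdA0 hδ₁
  obtain ⟨kB, hkB1, hkB, hfB⟩ := exists_sample_count hdB0 hδ₁
  obtain ⟨T, hT, hcard, hTg⟩ := exists_seed_count (Fintype.card X) (Fintype.card Y)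
    Fintype.card_pos Fintype.card_pos hδ₂
  obtain ⟨Q, hQ, hcost⟩ := P.exists_compressed hε hδ₁.le (half_pos hδ₂) hP
    (hfamA.measurable_mixture wA) (hwA.mixture_nonneg hcA hfamA)
    (hwA.sum_mixture (sum_msgDensity P.lawA P.measurable_msgA))
    (hfamB.measurable_mixture wB) (hwB.mixture_nonneg hcB hfamB)
    (hwB.sum_mixture (sum_msgDensity P.lawB P.measurable_msgB))
    (hwA.le_mul_mixture hcA hfamA) (hwB.le_mul_mixture hcB hfamB)
    (NA := 2 ^ kA) (NB := 2 ^ kB) (Nat.le_self_pow (by lia) 2) (Nat.le_self_pow (by lia) 2)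
    (fun x => hfA _ (hdA x)) (fun y => hfB _ (hdB y)) hT (by rw [Fintype.card_prod]; exact hcard)
  rw [add_assoc _ (δ₂ / 2), add_halves] at hQ
  have hCC : CCpriv f (ε + δ₁ + δ₂) ≤ Q.cost := Nat.sInf_le ⟨Q, hQ, rfl⟩
  have hCC' : CCpriv f (ε + δ₁ + δ₂) ≤ 2 * Nat.clog 2 T + kA + kB + 2 := by
    have h1 := clog_mul_succ_le T kA
    have h2 := clog_mul_succ_le T kB
    lia
  have hCCr : (CCpriv f (ε + δ₁ + δ₂) : ℝ) ≤ 2 * (Nat.clog 2 T : ℝ) + kA + kB + 2 := by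
    exact_mod_cast hCC'
  calc _ ≤ δ₁ * ((dA / Real.log 2 + 3) / δ₁ + (dB / Real.log 2 + 3) / δ₁) := by
        refine mul_le_mul_of_nonneg_left ?_ hδ₁.le
        linarith
    _ = (dA + dB) / Real.log 2 + 6 := by field_simp; ring
    _ ≤ _ := by linarith

end SMP

theorem mainTheorem3 {X Y : Type*} [Fintype X] [Fintype Y] [Nonempty X] [Nonempty Y]
    [MeasurableSpace X] [MeasurableSpace Y]
    [DiscreteMeasurableSpace X] [DiscreteMeasurableSpace Y]
    (f : X → Y → Bool) (ε δ₁ δ₂ : ℝ) (hε : 0 ≤ ε) (hδ₁ : 0 < δ₁) (hδ₂ : 0 < δ₂)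
    (hsum : ε + δ₁ + δ₂ < 1 / 2) :
    ((δ₁ * ((SMP.CCpriv f (ε + δ₁ + δ₂) : ℝ)
          - SMP.g₂ (Real.logb 2 (Fintype.card X)) (Real.logb 2 (Fintype.card Y)) δ₂ - 4)
        - 2 * SMP.g₁ (SMP.CCpriv f ε) : ℝ) : EReal)
      ≤ (SMP.IL f ε : EReal) := by
  -- Only the constant of `g₁` is needed: `2 * g₁ ≥ 20` covers the additive `8` of `le_leakage`,
  -- whatever the value of `CCpriv f ε`.
  have hg : 10 ≤ SMP.g₁ (SMP.CCpriv f ε) := by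
    have := Real.logb_nonneg one_lt_two
      (show (1 : ℝ) ≤ (SMP.CCpriv f ε : ℝ) + 1 by
        linarith [Nat.cast_nonneg (α := ℝ) (SMP.CCpriv f ε)])
    rw [SMP.g₁]
    linarith
  set A : ℝ := δ₁ * ((SMP.CCpriv f (ε + δ₁ + δ₂) : ℝ)
      - SMP.g₂ (Real.logb 2 (Fintype.card X)) (Real.logb 2 (Fintype.card Y)) δ₂ - 4)
    - 2 * SMP.g₁ (SMP.CCpriv f ε) with hA
  -- Truncation of a negative `A` to `0` does no harm, because `A ≤ max A 0` and the leakage is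
  -- nonnegative.
  have h : ENNReal.ofReal A ≤ SMP.IL f ε := by
    refine le_iInf₂ fun P hP => ?_
    by_cases hfin : P.leakage = ∞
    · rw [hfin]; exact le_top
    rw [ENNReal.ofReal_le_iff_le_toReal hfin]
    linarith [P.le_leakage hε hδ₁ hδ₂ hP hfin]
  calc (A : EReal) ≤ ((ENNReal.ofReal A : ℝ≥0∞) : EReal) := by
        rw [EReal.coe_ennreal_ofReal]
        exact EReal.coe_le_coe_iff.mpr (le_max_left _ _)
    _ ≤ _ := EReal.coe_ennreal_le_coe_ennreal_iff.mpr h
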